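/- There is an absolute constant $c > 0$ such that the following holds for every $n \ge 2$. Let $X = (X_1,\dots,X_n)$ be a random vector in $\mathbb{R}^n$ such that (i) $X$ is isotropic, i.e. its components are square integrable and uncorrelated, with mean zero and variance one; (ii) the distribution of $X$ is coordinate-wise symmetric, i.e. $(\varepsilon_1 X_1,\dots,\varepsilon_n X_n)$ has the same distribution as $X$ for every choice of signs $\varepsilon_i = \pm 1$; (iii) the distribution $\mu$ of $X$ is log-concave, i.e. $\mu(tA+(1-t)B) \ge \mu(A)^t\mu(B)^{1-t}$ for all non-empty compact sets $A,B\subset\mathbb{R}^n$ and all $0<t<1$, where $tA+(1-t)B=\{tx+(1-t)y : x\in A,\ y\in B\}$. Let $\sigma_4^2(X) = \frac1n \operatorname{Var}(|X|^2)$, where $|\cdot|$ is the Euclidean norm, and let $\Lambda(X) \in [0,\infty]$ be the smallest constant $\Lambda$ such that $$\operatorname{Var}\Big(\sum_{i,j=1}^n a_{ij}X_iX_j\Big) \le \Lambda \sum_{i,j=1}^n a_{ij}^2 \qquad\text{for all real numbers } a_{ij},\ 1\le i,j\le n.$$ Then $$\sigma_4^2(X) \le \Lambda(X) \le c .$$ 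-/

import Mathlib

open MeasureTheory ProbabilityTheory
open scoped ENNReal Pointwise

/-- A Borel measure `μ` on `ℝⁿ` is log-concave if
`μ (tA + (1-t)B) ≥ μ(A)^t μ(B)^(1-t)` for all non-empty compact sets `A`, `B` and `0 < t < 1`,
where `tA + (1-t)B` is the weighted Minkowski sum. -/
def IsLogConcaveMeasure {n : ℕ} (μ : Measure (EuclideanSpace ℝ (Fin n))) : Prop :=
  ∀ A B : Set (EuclideanSpace ℝ (Fin n)), IsCompact A → IsCompact B → A.Nonempty → B.Nonempty →
    ∀ t : ℝ, 0 < t → t < 1 →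
      μ A ^ t * μ B ^ (1 - t) ≤ μ (t • A + (1 - t) • B)

section RandomVector

variable {Ω : Type*} [MeasurableSpace Ω] {n : ℕ}

/-- A random vector is isotropic if its components are square integrable and uncorrelated, with
mean zero and variance one. -/
structure IsIsotropic (X : Ω → EuclideanSpace ℝ (Fin n)) (P : Measure Ω) : Prop where
  memLp : ∀ i, MemLp (fun ω => X ω i) 2 P
  mean_eq_zero : ∀ i, ∫ ω, X ω i ∂P = 0
  variance_eq_one : ∀ i, variance (fun ω => X ω i) P = 1
  covariance_eq_zero : ∀ i j, i ≠ j → covariance (fun ω => X ω i) (fun ω => X ω j) P = 0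

/-- The distribution of `X` is coordinate-wise symmetric if `(ε₁X₁, …, εₙXₙ)` has the same
distribution as `X` for every choice of signs `εᵢ = ±1`. -/
def IsCoordinatewiseSymmetric (X : Ω → EuclideanSpace ℝ (Fin n)) (P : Measure Ω) : Prop :=
  ∀ ε : Fin n → ℝ, (∀ i, ε i = 1 ∨ ε i = -1) →
    IdentDistrib (fun ω => WithLp.toLp 2 (fun i => ε i * X ω i)) X P P

/-- `X` satisfies the second order correlation condition with constant `L`:
`Var(∑ aᵢⱼ Xᵢ Xⱼ) ≤ L ∑ aᵢⱼ²` for every real matrix `(aᵢⱼ)`. The variance takes values in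
`[0, ∞]`; when the variables `Xᵢ Xⱼ` are integrable, it is infinite exactly when
`∑ aᵢⱼ Xᵢ Xⱼ` is not square integrable. -/
def SecondOrderCorrelation (X : Ω → EuclideanSpace ℝ (Fin n)) (P : Measure Ω) (L : ℝ≥0∞) : Prop :=
  ∀ a : Fin n → Fin n → ℝ,
    evariance (fun ω => ∑ i, ∑ j, a i j * X ω i * X ω j) P ≤
      L * ENNReal.ofReal (∑ i, ∑ j, a i j ^ 2)

/-- `Λ(X)`, the optimal (smallest) constant in the second order correlation condition, an element
of `[0, ∞]`. -/
noncomputable def optimalLambda (X : Ω → EuclideanSpace ℝ (Fin n)) (P : Measure Ω) : ℝ≥0∞ :=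
  sInf {L : ℝ≥0∞ | SecondOrderCorrelation X P L}

/-- `σ₄²(X) = Var(|X|²) / n`, an element of `[0, ∞]`. -/
noncomputable def sigmaFourSq (X : Ω → EuclideanSpace ℝ (Fin n)) (P : Measure Ω) : ℝ≥0∞ :=
  evariance (fun ω => ‖X ω‖ ^ 2) P / (n : ℝ≥0∞)

end RandomVector

/-! The lower bound is the choice of the identity matrix. For the upper bound, a quadratic form is
split into its diagonal and off-diagonal parts. Off the diagonal, sign symmetry kills every mixed
moment `E[XᵢXⱼXₖXₗ]` except the pairings of `(k, l)` with `(i, j)`, and the survivors are bounded by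
fourth moments. These are bounded absolutely, because a symmetric log-concave variable of variance
one has exponential tails (`measure_tail_le`).

The diagonal part rests on a Prékopa-Leindler inequality after the substitution `xᵢ = rᵢ²` on the
positive orthant. An unconditional log-concave function decreases in each `|xᵢ|`, and `((r + q) /
2)² ≤ (r² + q²) / 2`, so it remains midpoint log-concave in the variables `r`. The Jacobian gives
something extra: with `τ = (r - q) / (r + q)`, the product `r q` is smaller than `((r + q) / 2)²` by
the factor `1 - τ² ≤ exp (-τ²)`. This gain pays for multiplying one function by `exp (b x² - 8 b²
x⁴)` and the other by `exp (-b x² - 8 b² x⁴)` (`exp_mul_le_sq_mean`). Hence the two tilted integrals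
have product at most the square of the untilted one (`lintegral_quarticTilt_mul_le`).

No density is needed: the inequality is applied to `x ↦ μ (closedBall x δ)`, and `δ → 0` by Fatou
(`lintegral_quarticTilt_mul_le_one`). Expanding to second order in the size of `b` turns it into
`Var (∑ aᵢ xᵢ²) ≤ 16 ∑ aᵢ² E xᵢ⁴` (`evariance_le_of_lintegral_exp`, `evariance_sum_sq_le`). -/

/-! ### Brunn-Minkowski and Prékopa-Leindler on the line -/

/-- With `a = max A` and `b = min B`, the half-size copies `(A + b) / 2` and `(a + B) / 2` both lie
in `H` and meet at most at `(a + b) / 2`. -/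
theorem volume_add_volume_le_of_isCompact {A B H : Set ℝ} (hA : IsCompact A) (hB : IsCompact B)
    (hA' : A.Nonempty) (hB' : B.Nonempty) (h : ∀ x ∈ A, ∀ y ∈ B, (x + y) / 2 ∈ H) :
    volume A + volume B ≤ 2 * volume H := by
  obtain ⟨a, haA, ha⟩ := hA.exists_isGreatest hA'
  obtain ⟨b, hbB, hb⟩ := hB.exists_isLeast hB'
  set φ := AffineMap.homothety b (1 / 2 : ℝ) with hφ
  set ψ := AffineMap.homothety a (1 / 2 : ℝ) with hψ
  have hφx (x : ℝ) : φ x = (x + b) / 2 := by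
    simp only [hφ, AffineMap.homothety_apply, vsub_eq_sub, smul_eq_mul, vadd_eq_add]; ring
  have hψx (x : ℝ) : ψ x = (a + x) / 2 := by
    simp only [hψ, AffineMap.homothety_apply, vsub_eq_sub, smul_eq_mul, vadd_eq_add]; ring
  have hvA : volume (φ '' A) = 2⁻¹ * volume A := by
    rw [hφ, Measure.addHaar_image_homothety]
    simp [ENNReal.ofReal_inv_of_pos]
  have hvB : volume (ψ '' B) = 2⁻¹ * volume B := by
    rw [hψ, Measure.addHaar_image_homothety]
    simp [ENNReal.ofReal_inv_of_pos]
  have hdisj : AEDisjoint volume (φ '' A) (ψ '' B) := by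
    refine measure_mono_null (t := {(a + b) / 2}) ?_ (by simp)
    rintro z ⟨⟨x, hx, hxz⟩, ⟨y, hy, hyz⟩⟩
    rw [hφx] at hxz
    rw [hψx] at hyz
    have h1 := ha hx
    have h2 := hb hy
    simp only [Set.mem_singleton_iff]
    linarith
  have hmeas : NullMeasurableSet (ψ '' B) volume := by
    have hc : Continuous ψ := by
      have : (ψ : ℝ → ℝ) = fun x => (a + x) / 2 := funext hψx
      rw [this]; fun_prop
    exact (hB.image hc).measurableSet.nullMeasurableSet
  have hsub : φ '' A ∪ ψ '' B ⊆ H := by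
    rintro z (⟨x, hx, rfl⟩ | ⟨y, hy, rfl⟩)
    · rw [hφx]; exact h x hx b hbB
    · rw [hψx]; exact h a haA y hy
  have key : 2⁻¹ * volume A + 2⁻¹ * volume B ≤ volume H := by
    rw [← hvA, ← hvB, ← measure_union₀ hmeas hdisj]
    exact measure_mono hsub
  calc volume A + volume B = 2 * (2⁻¹ * volume A + 2⁻¹ * volume B) := by
        rw [← mul_add, ← mul_assoc, ENNReal.mul_inv_cancel (by simp) (by simp), one_mul]
    _ ≤ _ := by gcongr

/-- The one-dimensional Brunn-Minkowski inequality. -/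
theorem volume_add_volume_le {A B H : Set ℝ} (hA : MeasurableSet A) (hB : MeasurableSet B)
    (hA' : A.Nonempty) (hB' : B.Nonempty) (h : ∀ x ∈ A, ∀ y ∈ B, (x + y) / 2 ∈ H) :
    volume A + volume B ≤ 2 * volume H := by
  obtain ⟨a, ha⟩ := hA'
  obtain ⟨b, hb⟩ := hB'
  refine ENNReal.le_of_forall_pos_le_add fun ε hε hfin => ?_
  -- If a set has infinite measure, a compact piece of it averaged with a single point of the other
  -- set already exceeds the finite bound.
  by_cases hAt : volume A = ∞
  · obtain ⟨K, hK, hKc, hlt⟩ := hA.exists_lt_isCompact (μ := volume) (r := 2 * volume H)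
      (by rw [hAt]; exact lt_of_le_of_ne le_top hfin.ne)
    have := volume_add_volume_le_of_isCompact hKc (isCompact_singleton (x := b)) (H := H)
      (by
        rcases K.eq_empty_or_nonempty with rfl | h
        · simp at hlt
        · exact h) ⟨b, rfl⟩ (by rintro x hx y rfl; exact h x (hK hx) _ hb)
    simp only [measure_singleton, add_zero] at this
    exact absurd hlt (not_lt.2 this)
  by_cases hBt : volume B = ∞
  · obtain ⟨K, hK, hKc, hlt⟩ := hB.exists_lt_isCompact (μ := volume) (r := 2 * volume H)
      (by rw [hBt]; exact lt_of_le_of_ne le_top hfin.ne)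
    have := volume_add_volume_le_of_isCompact (isCompact_singleton (x := a)) hKc (H := H)
      ⟨a, rfl⟩ (by
        rcases K.eq_empty_or_nonempty with rfl | h
        · simp at hlt
        · exact h) (by rintro x rfl y hy; exact h _ ha y (hK hy))
    simp only [measure_singleton, zero_add] at this
    exact absurd hlt (not_lt.2 this)
  have hε2 : ((ε / 2 : NNReal) : ℝ≥0∞) ≠ 0 := by
    rw [ne_eq, ENNReal.coe_eq_zero]; exact (half_pos hε).ne'
  obtain ⟨K, hK, hKc, hKlt⟩ := hA.exists_isCompact_lt_add hAt hε2
  obtain ⟨L, hL, hLc, hLlt⟩ := hB.exists_isCompact_lt_add hBt hε2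
  -- The approximating compacts may be empty; inserting `a` and `b` repairs this.
  have hKL := volume_add_volume_le_of_isCompact (H := H) (hKc.insert a) (hLc.insert b)
    (Set.insert_nonempty _ _) (Set.insert_nonempty _ _) (by
      intro x hx y hy
      exact h x (Set.insert_subset ha hK hx) y (Set.insert_subset hb hL hy))
  have h2 : (ε : ℝ≥0∞) = (ε / 2 : NNReal) + (ε / 2 : NNReal) := by
    rw [← ENNReal.coe_add, add_halves]
  calc volume A + volume B ≤ (volume (insert a K) + (ε / 2 : NNReal)) +
        (volume (insert b L) + (ε / 2 : NNReal)) := by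
        gcongr
        · exact hKlt.le.trans (by gcongr; exact Set.subset_insert _ _)
        · exact hLlt.le.trans (by gcongr; exact Set.subset_insert _ _)
    _ = (volume (insert a K) + volume (insert b L)) + ε := by rw [h2]; ring
    _ ≤ _ := by gcongr

/-- Layer cake: for `0 < t < 1` the superlevel sets of `f` and `g` are non-empty, and their
midpoints lie in that of `h`, so Brunn-Minkowski applies level by level. For `t ≥ 1` the left side
vanishes. -/
theorem lintegral_add_lintegral_le_of_le_one {f g h : ℝ → ℝ} (hf : Measurable f)
    (hg : Measurable g) (hh : Measurable h) (hf0 : ∀ x, 0 ≤ f x) (hg0 : ∀ x, 0 ≤ g x)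
    (hh0 : ∀ x, 0 ≤ h x) (hf1 : ∀ x, f x ≤ 1) (hg1 : ∀ x, g x ≤ 1)
    (hfs : ∀ l < 1, ∃ x, l < f x) (hgs : ∀ l < 1, ∃ x, l < g x)
    (hfg : ∀ x y, f x * g y ≤ h ((x + y) / 2) ^ 2) :
    (∫⁻ x, ENNReal.ofReal (f x)) + ∫⁻ x, ENNReal.ofReal (g x)
      ≤ 2 * ∫⁻ x, ENNReal.ofReal (h x) := by
  have cake (u : ℝ → ℝ) (hu : Measurable u) (hu0 : ∀ x, 0 ≤ u x) :
      ∫⁻ x, ENNReal.ofReal (u x) = ∫⁻ t in Set.Ioi (0 : ℝ), volume {a | t < u a} :=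
    lintegral_eq_lintegral_meas_lt _ (Filter.Eventually.of_forall hu0) hu.aemeasurable
  have hmeas (u : ℝ → ℝ) : Measurable fun t => volume {a | t < u a} := by
    apply Antitone.measurable
    intro s t hst
    exact measure_mono fun a (ha : t < u a) => lt_of_le_of_lt hst ha
  rw [cake f hf hf0, cake g hg hg0, cake h hh hh0, ← lintegral_add_left (hmeas f),
    ← lintegral_const_mul _ (hmeas h)]
  refine setLIntegral_mono' measurableSet_Ioi fun t ht => ?_
  rcases lt_or_ge t 1 with h1 | h1
  · refine volume_add_volume_le (measurableSet_lt measurable_const hf)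
      (measurableSet_lt measurable_const hg) (hfs t h1) (hgs t h1) ?_
    intro x hx y hy
    have ht0 : (0 : ℝ) < t := ht
    have h2 : t * t < f x * g y := mul_lt_mul'' hx hy ht0.le ht0.le
    have h3 := hfg x y
    simp only [Set.mem_ofPred_eq]
    exact lt_of_pow_lt_pow_left₀ 2 (hh0 _) (by nlinarith)
  · have e1 : {a | t < f a} = ∅ := by
      ext a; simp [(hf1 a).trans h1]
    have e2 : {a | t < g a} = ∅ := by
      ext a; simp [(hg1 a).trans h1]
    simp [e1, e2]

theorem ENNReal.mul_le_sq_of_add_le_two_mul {a b c : ℝ≥0∞} (h : a + b ≤ 2 * c) :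
    a * b ≤ c ^ 2 := by
  by_cases hc : c = ∞
  · simp [hc]
  have hfin : a + b ≠ ∞ := ne_top_of_le_ne_top (ENNReal.mul_ne_top (by simp) hc) h
  have ha : a ≠ ∞ := fun h => hfin (by simp [h])
  have hb : b ≠ ∞ := fun h => hfin (by simp [h])
  lift a to NNReal using ha
  lift b to NNReal using hb
  lift c to NNReal using hc
  norm_cast at h ⊢
  have h' : (a : ℝ) + b ≤ 2 * c := by exact_mod_cast h
  have ha := a.coe_nonneg
  have hb := b.coe_nonneg
  have : (a : ℝ) * b ≤ c ^ 2 := by nlinarith [sq_nonneg ((a : ℝ) - b)]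
  exact_mod_cast this

/-- Dividing `f`, `g`, `h` by `S`, `T`, `√(S T)` preserves the hypothesis and makes both suprema
equal to one; the additive bound then gives the multiplicative one by the arithmetic-geometric mean
inequality. -/
theorem prekopa_leindler_real {f g h : ℝ → ℝ} (hf : Measurable f)
    (hg : Measurable g) (hh : Measurable h) (hf0 : ∀ x, 0 ≤ f x) (hg0 : ∀ x, 0 ≤ g x)
    (hh0 : ∀ x, 0 ≤ h x) (hfb : BddAbove (Set.range f)) (hgb : BddAbove (Set.range g))
    (hfg : ∀ x y, f x * g y ≤ h ((x + y) / 2) ^ 2) :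
    (∫⁻ x, ENNReal.ofReal (f x)) * ∫⁻ x, ENNReal.ofReal (g x)
      ≤ (∫⁻ x, ENNReal.ofReal (h x)) ^ 2 := by
  set S := ⨆ x, f x with hS
  set T := ⨆ x, g x with hT
  have hfS (x) : f x ≤ S := le_ciSup hfb x
  have hgT (x) : g x ≤ T := le_ciSup hgb x
  rcases ((hf0 0).trans (hfS 0)).eq_or_lt with hS0 | hS0
  · have : ∀ x, f x = 0 := fun x => le_antisymm (hS0 ▸ hfS x) (hf0 x)
    simp [this]
  rcases ((hg0 0).trans (hgT 0)).eq_or_lt with hT0 | hT0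
  · have : ∀ x, g x = 0 := fun x => le_antisymm (hT0 ▸ hgT x) (hg0 x)
    simp [this]
  have hST : 0 < S * T := mul_pos hS0 hT0
  have key := lintegral_add_lintegral_le_of_le_one (f := fun x => S⁻¹ * f x)
    (g := fun x => T⁻¹ * g x) (h := fun x => (√(S * T))⁻¹ * h x)
    (by fun_prop) (by fun_prop) (by fun_prop)
    (fun x => mul_nonneg (by positivity) (hf0 x)) (fun x => mul_nonneg (by positivity) (hg0 x))
    (fun x => mul_nonneg (by positivity) (hh0 x))
    (fun x => by rw [inv_mul_le_iff₀ hS0, mul_one]; exact hfS x)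
    (fun x => by rw [inv_mul_le_iff₀ hT0, mul_one]; exact hgT x)
    (fun l hl => by
      obtain ⟨x, hx⟩ := exists_lt_of_lt_ciSup (show S * l < ⨆ x, f x by nlinarith)
      exact ⟨x, by rwa [lt_inv_mul_iff₀ hS0]⟩)
    (fun l hl => by
      obtain ⟨x, hx⟩ := exists_lt_of_lt_ciSup (show T * l < ⨆ x, g x by nlinarith)
      exact ⟨x, by rwa [lt_inv_mul_iff₀ hT0]⟩)
    (fun x y => by
      rw [mul_pow, inv_pow, Real.sq_sqrt hST.le, mul_inv]
      calc S⁻¹ * f x * (T⁻¹ * g y) = S⁻¹ * T⁻¹ * (f x * g y) := by ring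
        _ ≤ _ := by gcongr; exact hfg x y)
  have pull (u : ℝ → ℝ) (hu : Measurable u) (c : ℝ) (hc : 0 < c) :
      ∫⁻ x, ENNReal.ofReal (c⁻¹ * u x)
        = (ENNReal.ofReal c)⁻¹ * ∫⁻ x, ENNReal.ofReal (u x) := by
    rw [← lintegral_const_mul _ (by fun_prop)]
    simp_rw [ENNReal.ofReal_mul (inv_nonneg.2 hc.le), ENNReal.ofReal_inv_of_pos hc]
  rw [pull f hf S hS0, pull g hg T hT0, pull h hh _ (Real.sqrt_pos.2 hST)] at key
  have key2 := ENNReal.mul_le_sq_of_add_le_two_mul key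
  set a := ∫⁻ x, ENNReal.ofReal (f x)
  set b := ∫⁻ x, ENNReal.ofReal (g x)
  set c := ∫⁻ x, ENNReal.ofReal (h x)
  have hs : ENNReal.ofReal (√(S * T)) ^ 2 = ENNReal.ofReal S * ENNReal.ofReal T := by
    rw [← ENNReal.ofReal_pow (Real.sqrt_nonneg _), Real.sq_sqrt hST.le, ENNReal.ofReal_mul hS0.le]
  have hSc : ENNReal.ofReal S * (ENNReal.ofReal S)⁻¹ = 1 :=
    ENNReal.mul_inv_cancel (by simpa using hS0) (by simp)
  have hTc : ENNReal.ofReal T * (ENNReal.ofReal T)⁻¹ = 1 :=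
    ENNReal.mul_inv_cancel (by simpa using hT0) (by simp)
  have hrc : ENNReal.ofReal (√(S * T)) * (ENNReal.ofReal (√(S * T)))⁻¹ = 1 :=
    ENNReal.mul_inv_cancel (by simpa using hST) (by simp)
  calc a * b = (ENNReal.ofReal S * (ENNReal.ofReal S)⁻¹) *
        (ENNReal.ofReal T * (ENNReal.ofReal T)⁻¹) * (a * b) := by rw [hSc, hTc]; simp
    _ = (ENNReal.ofReal S * ENNReal.ofReal T) *
        ((ENNReal.ofReal S)⁻¹ * a * ((ENNReal.ofReal T)⁻¹ * b)) := by ring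
    _ ≤ (ENNReal.ofReal S * ENNReal.ofReal T) * ((ENNReal.ofReal (√(S * T)))⁻¹ * c) ^ 2 := by
        gcongr
    _ = (ENNReal.ofReal (√(S * T)) * (ENNReal.ofReal (√(S * T)))⁻¹) ^ 2 * c ^ 2 := by
        rw [← hs]; ring
    _ = c ^ 2 := by rw [hrc]; simp

/-- The one-dimensional Prékopa-Leindler inequality for midpoints. -/
theorem prekopa_leindler {f g h : ℝ → ℝ≥0∞} (hf : Measurable f)
    (hg : Measurable g) (hh : Measurable h)
    (hfg : ∀ x y, f x * g y ≤ h ((x + y) / 2) ^ 2) :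
    (∫⁻ x, f x) * ∫⁻ x, g x ≤ (∫⁻ x, h x) ^ 2 := by
  have trunc (u : ℝ → ℝ≥0∞) (hu : Measurable u) :
      ∫⁻ x, u x = ⨆ N : ℕ, ∫⁻ x, min (u x) N := by
    rw [← lintegral_iSup (fun N => hu.min measurable_const)]
    · congr 1
      ext x
      rw [← inf_iSup_eq, ENNReal.iSup_natCast, inf_top_eq]
    · intro N M hNM x
      exact min_le_min le_rfl (by exact_mod_cast hNM)
  rw [trunc f hf, trunc g hg, ENNReal.iSup_mul]
  refine iSup_le fun N => ?_
  rw [ENNReal.mul_iSup]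
  refine iSup_le fun M => ?_
  have toR (u : ℝ → ℝ≥0∞) (K : ℕ) :
      ∫⁻ x, min (u x) K = ∫⁻ x, ENNReal.ofReal (min (u x) K).toReal := by
    refine lintegral_congr fun x => ?_
    rw [ENNReal.ofReal_toReal]
    exact ne_top_of_le_ne_top (by simp) (min_le_right _ (K : ℝ≥0∞))
  have hb (u : ℝ → ℝ≥0∞) (K : ℕ) : BddAbove (Set.range fun x => (min (u x) K).toReal) := by
    refine ⟨K, ?_⟩
    rintro _ ⟨x, rfl⟩
    exact ENNReal.toReal_le_of_le_ofReal (by positivity) (by simp)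
  -- Capping `h` at `max N M` preserves the hypothesis: where the cap is active, its square
  -- dominates `N * M`.
  calc (∫⁻ x, min (f x) N) * ∫⁻ x, min (g x) M
      ≤ (∫⁻ x, min (h x) (max N M : ℕ)) ^ 2 := by
        rw [toR f, toR g, toR h]
        refine prekopa_leindler_real ?_ ?_ ?_ (fun _ => ENNReal.toReal_nonneg)
          (fun _ => ENNReal.toReal_nonneg) (fun _ => ENNReal.toReal_nonneg) (hb f N) (hb g M) ?_
        · exact (hf.min measurable_const).ennreal_toReal
        · exact (hg.min measurable_const).ennreal_toReal
        · exact (hh.min measurable_const).ennreal_toReal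
        · intro x y
          rw [← ENNReal.toReal_mul, ← ENNReal.toReal_pow]
          refine ENNReal.toReal_mono ?_ ?_
          · exact ENNReal.pow_ne_top
              (ne_top_of_le_ne_top (by simp) (min_le_right _ ((max N M : ℕ) : ℝ≥0∞)))
          · rcases le_total (h ((x + y) / 2)) ((max N M : ℕ) : ℝ≥0∞) with hle | hle
            · rw [min_eq_left hle]
              exact (mul_le_mul' (min_le_left _ _) (min_le_left _ _)).trans (hfg x y)
            · rw [min_eq_right hle, sq]
              refine mul_le_mul' ((min_le_right _ _).trans ?_) ((min_le_right _ _).trans ?_)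
              · exact_mod_cast le_max_left N M
              · exact_mod_cast le_max_right N M
    _ ≤ _ := by
        gcongr
        exact min_le_left _ _

/-! ### Prékopa-Leindler in square-root coordinates -/

theorem lintegral_eq_lintegral_Ioi_of_abs {f : ℝ → ℝ≥0∞} (hf : ∀ x, f |x| = f x) :
    ∫⁻ x, f x = 2 * ∫⁻ x in Set.Ioi 0, f x := by
  have h1 : ∫⁻ x in Set.Iio 0, f x = ∫⁻ x in Set.Ioi 0, f x := by
    rw [← (Measure.measurePreserving_neg (volume : Measure ℝ)).setLIntegral_comp_preimage_emb
      (MeasurableEquiv.neg ℝ).measurableEmbedding]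
    simp only [Set.neg_preimage, Set.neg_Iio, neg_zero]
    refine lintegral_congr fun x => ?_
    rw [← hf, abs_neg, hf]
  rw [← lintegral_add_compl f (measurableSet_Ioi : MeasurableSet (Set.Ioi (0 : ℝ))), Set.compl_Ioi,
    setLIntegral_congr (Iio_ae_eq_Iic (a := (0 : ℝ))).symm, h1, two_mul]

/-- Evenness gives one factor 2 and the Jacobian `2 t` of `x = t²` the other. -/
theorem lintegral_eq_lintegral_sq_of_abs {f : ℝ → ℝ≥0∞} (hf : ∀ x, f |x| = f x) :
    ∫⁻ x, f x = 4 * ∫⁻ t, (Set.Ioi 0).indicator (fun t => f (t ^ 2) * ENNReal.ofReal t) t := by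
  have himg : (fun t : ℝ => t ^ 2) '' Set.Ioi 0 = Set.Ioi 0 := by
    ext y
    constructor
    · rintro ⟨t, ht, rfl⟩
      have : (0 : ℝ) < t := ht
      exact pow_pos this 2
    · intro hy
      exact ⟨√y, Real.sqrt_pos.2 hy, Real.sq_sqrt (le_of_lt hy)⟩
  have hinj : Set.InjOn (fun t : ℝ => t ^ 2) (Set.Ioi 0) := by
    intro x hx y hy hxy
    exact (pow_left_inj₀ (le_of_lt hx) (le_of_lt hy) two_ne_zero).1 hxy
  rw [lintegral_eq_lintegral_Ioi_of_abs hf, lintegral_indicator measurableSet_Ioi]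
  conv_lhs => rw [← himg]
  rw [lintegral_image_eq_lintegral_abs_deriv_mul (f' := fun t => 2 * t) measurableSet_Ioi
    (fun x _ => by simpa using (hasDerivAt_pow 2 x).hasDerivWithinAt) hinj]
  rw [show (4 : ℝ≥0∞) = 2 * 2 by norm_num, mul_assoc]
  congr 1
  rw [← lintegral_const_mul' 2 _ (by simp)]
  refine setLIntegral_congr_fun measurableSet_Ioi fun t ht => ?_
  have ht : (0 : ℝ) < t := ht
  rw [abs_of_pos (by positivity), ENNReal.ofReal_mul (by norm_num)]
  simp only [ENNReal.ofReal_ofNat]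
  ring

/-- A Prékopa-Leindler inequality on the half-line for the mean `((√x + √y) / 2) ^ 2`. -/
theorem prekopa_leindler_sq {f g h : ℝ → ℝ≥0∞} (hf : Measurable f)
    (hg : Measurable g) (hh : Measurable h)
    (hfa : ∀ x, f |x| = f x) (hga : ∀ x, g |x| = g x) (hha : ∀ x, h |x| = h x)
    (hfg : ∀ r q : ℝ, 0 < r → 0 < q →
      f (r ^ 2) * ENNReal.ofReal r * (g (q ^ 2) * ENNReal.ofReal q)
        ≤ (h (((r + q) / 2) ^ 2) * ENNReal.ofReal ((r + q) / 2)) ^ 2) :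
    (∫⁻ x, f x) * ∫⁻ x, g x ≤ (∫⁻ x, h x) ^ 2 := by
  rw [lintegral_eq_lintegral_sq_of_abs hfa, lintegral_eq_lintegral_sq_of_abs hga,
    lintegral_eq_lintegral_sq_of_abs hha]
  have hm (u : ℝ → ℝ≥0∞) (hu : Measurable u) :
      Measurable ((Set.Ioi (0 : ℝ)).indicator (fun t => u (t ^ 2) * ENNReal.ofReal t)) :=
    Measurable.indicator (by fun_prop) measurableSet_Ioi
  have key := prekopa_leindler (hm f hf) (hm g hg) (hm h hh) (by
    intro r q
    by_cases hr : 0 < r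
    · by_cases hq : 0 < q
      · rw [Set.indicator_of_mem (Set.mem_Ioi.2 hr), Set.indicator_of_mem (Set.mem_Ioi.2 hq),
          Set.indicator_of_mem (Set.mem_Ioi.2 (by linarith))]
        exact hfg r q hr hq
      · simp [hq]
    · simp [hr])
  calc _ = 16 * _ := by rw [mul_mul_mul_comm]; norm_num
    _ ≤ 16 * _ := mul_le_mul_right key _
    _ = _ := by rw [mul_pow]; norm_num

theorem lintegral_fin_succ {n : ℕ} {f : (Fin (n + 1) → ℝ) → ℝ≥0∞} (hf : Measurable f) :
    ∫⁻ x, f x = ∫⁻ t : ℝ, ∫⁻ y : Fin n → ℝ, f (Fin.cons t y) := by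
  have h := (volume_preserving_piFinSuccAbove (fun _ : Fin (n + 1) => ℝ) 0).symm
  rw [← h.lintegral_comp hf, Measure.volume_eq_prod, lintegral_prod]
  · simp only [MeasurableEquiv.piFinSuccAbove_symm_apply, Fin.insertNthEquiv_zero]
    rfl
  · exact (hf.comp h.measurable).aemeasurable

theorem measurable_fin_cons {n : ℕ} :
    Measurable fun p : ℝ × (Fin n → ℝ) => (Fin.cons p.1 p.2 : Fin (n + 1) → ℝ) := by
  refine measurable_pi_iff.2 fun i => ?_
  refine Fin.cases ?_ (fun j => ?_) i
  · simpa using measurable_fst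
  · simpa using! (measurable_pi_apply j).comp measurable_snd

theorem abs_fin_cons {n : ℕ} (t : ℝ) (y : Fin n → ℝ) :
    |(Fin.cons t y : Fin (n + 1) → ℝ)| = Fin.cons |t| |y| := by
  ext i
  refine Fin.cases ?_ (fun j => ?_) i <;> simp

/-- A Prékopa-Leindler inequality on the orthant for the coordinatewise mean
`((√x + √y) / 2) ^ 2`. -/
theorem prekopa_leindler_pi_sq {n : ℕ} {f g h : (Fin n → ℝ) → ℝ≥0∞} (hf : Measurable f)
    (hg : Measurable g) (hh : Measurable h)
    (hfa : ∀ x, f |x| = f x) (hga : ∀ x, g |x| = g x) (hha : ∀ x, h |x| = h x)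
    (hfg : ∀ r q : Fin n → ℝ, (∀ i, 0 < r i) → (∀ i, 0 < q i) →
      f (fun i => r i ^ 2) * (∏ i, ENNReal.ofReal (r i)) *
        (g (fun i => q i ^ 2) * ∏ i, ENNReal.ofReal (q i))
        ≤ (h (fun i => ((r i + q i) / 2) ^ 2) * ∏ i, ENNReal.ofReal ((r i + q i) / 2)) ^ 2) :
    (∫⁻ x, f x) * ∫⁻ x, g x ≤ (∫⁻ x, h x) ^ 2 := by
  induction n with
  | zero =>
    have := hfg (fun _ => 1) (fun _ => 1) (by simp) (by simp)
    have e (u : (Fin 0 → ℝ) → ℝ≥0∞) (z : Fin 0 → ℝ) : ∫⁻ x, u x = u z := by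
      rw [lintegral_unique]
      simp only [volume_pi, Measure.pi_univ, Finset.univ_eq_empty, Finset.prod_empty, mul_one]
      exact congrArg u (Subsingleton.elim _ _)
    rw [e f (fun i => 1 ^ 2), e g (fun i => 1 ^ 2), e h (fun i => ((1 + 1) / 2) ^ 2)]
    simpa using this
  | succ n ih =>
    rw [lintegral_fin_succ hf, lintegral_fin_succ hg, lintegral_fin_succ hh]
    have hm (u : (Fin (n + 1) → ℝ) → ℝ≥0∞) (hu : Measurable u) :
        Measurable fun t : ℝ => ∫⁻ y : Fin n → ℝ, u (Fin.cons t y) :=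
      (hu.comp measurable_fin_cons).lintegral_prod_right'
    have hs (u : (Fin (n + 1) → ℝ) → ℝ≥0∞) (hu : Measurable u) (t : ℝ) :
        Measurable fun y : Fin n → ℝ => u (Fin.cons t y) :=
      hu.comp (measurable_fin_cons.comp measurable_prodMk_left)
    have hab (u : (Fin (n + 1) → ℝ) → ℝ≥0∞) (hu : ∀ x, u |x| = u x) (t : ℝ) (y : Fin n → ℝ) :
        u (Fin.cons |t| y) = u (Fin.cons t y) := by
      rw [← hu (Fin.cons t y), ← hu (Fin.cons |t| y), abs_fin_cons, abs_fin_cons, abs_abs]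
    have hab' (u : (Fin (n + 1) → ℝ) → ℝ≥0∞) (hu : ∀ x, u |x| = u x) (t : ℝ) (y : Fin n → ℝ) :
        u (Fin.cons t |y|) = u (Fin.cons t y) := by
      rw [← hu (Fin.cons t y), ← hu (Fin.cons t |y|), abs_fin_cons, abs_fin_cons, abs_abs]
    refine prekopa_leindler_sq (hm f hf) (hm g hg) (hm h hh)
      (fun t => lintegral_congr fun y => hab f hfa t y)
      (fun t => lintegral_congr fun y => hab g hga t y)
      (fun t => lintegral_congr fun y => hab h hha t y) fun r₀ q₀ hr₀ hq₀ => ?_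
    -- The Jacobian factor of the first coordinate is constant in the others, so it is absorbed into
    -- the function before the induction hypothesis is used.
    rw [← lintegral_mul_const _ (hs f hf _), ← lintegral_mul_const _ (hs g hg _),
      ← lintegral_mul_const _ (hs h hh _)]
    refine ih ((hs f hf _).mul_const _) ((hs g hg _).mul_const _) ((hs h hh _).mul_const _)
      (fun y => by rw [hab' f hfa]) (fun y => by rw [hab' g hga]) (fun y => by rw [hab' h hha])
      fun r q hr hq => ?_
    have key := hfg (Fin.cons r₀ r) (Fin.cons q₀ q)
      (fun i => by refine Fin.cases ?_ (fun j => ?_) i <;> simp [hr₀, hr])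
      (fun i => by refine Fin.cases ?_ (fun j => ?_) i <;> simp [hq₀, hq])
    have e1 (s₀ : ℝ) (s : Fin n → ℝ) : (fun i => (Fin.cons s₀ s : Fin (n + 1) → ℝ) i ^ 2)
        = (Fin.cons (s₀ ^ 2) (fun i => s i ^ 2) : Fin (n + 1) → ℝ) := by
      ext i
      refine Fin.cases ?_ (fun j => ?_) i <;> simp
    have e2 : (fun i => (((Fin.cons r₀ r : Fin (n + 1) → ℝ) i
          + (Fin.cons q₀ q : Fin (n + 1) → ℝ) i) / 2) ^ 2)
        = (Fin.cons (((r₀ + q₀) / 2) ^ 2) (fun i => ((r i + q i) / 2) ^ 2) : Fin (n + 1) → ℝ) := by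
      ext i
      refine Fin.cases ?_ (fun j => ?_) i <;> simp
    rw [e1, e1, e2] at key
    simpa only [Fin.prod_univ_succ, Fin.cons_zero, Fin.cons_succ, mul_assoc] using key

/-! ### Monotonicity and the tilted inequality -/

/-- Coordinates are lowered one at a time: the new point lies on the segment between the old one and
its reflection, where `F` takes equal values. -/
theorem antitone_abs_of_logConcave {n : ℕ} {F : (Fin n → ℝ) → ℝ≥0∞}
    (hF : ∀ x y : Fin n → ℝ, ∀ t : ℝ, 0 < t → t < 1 →
      F x ^ t * F y ^ (1 - t) ≤ F (t • x + (1 - t) • y))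
    (hFa : ∀ x, F |x| = F x) {z w : Fin n → ℝ} (hzw : ∀ i, |z i| ≤ w i) : F w ≤ F z := by
  classical
  have step (v : Fin n → ℝ) (i : Fin n) (c : ℝ) (hc : |c| ≤ v i) :
      F v ≤ F (Function.update v i c) := by
    have hflip : F (Function.update v i (-v i)) = F v := by
      rw [← hFa v, ← hFa (Function.update v i (-v i))]
      congr 1
      ext j
      rcases eq_or_ne j i with rfl | hj <;> simp [*]
    obtain ⟨h1, h2⟩ := abs_le.1 hc
    -- The endpoints are treated apart because the weight `t` must be strictly between 0 and 1; this
    -- also disposes of `v i = 0`.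
    rcases h1.eq_or_lt with h1 | h1
    · rw [← h1, hflip]
    rcases h2.eq_or_lt with h2 | h2
    · rw [h2, Function.update_eq_self]
    have hw : 0 < v i := by linarith
    set t := (v i + c) / (2 * v i) with ht
    have ht0 : 0 < t := by rw [ht]; exact div_pos (by linarith) (by linarith)
    have ht1 : t < 1 := by rw [ht, div_lt_one (by linarith)]; linarith
    have key := hF v (Function.update v i (-v i)) t ht0 ht1
    rw [hflip, ← ENNReal.rpow_add_of_nonneg _ _ ht0.le (by linarith), add_sub_cancel,
      ENNReal.rpow_one] at key
    convert key using 2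
    ext j
    rcases eq_or_ne j i with rfl | hj
    · simp [ht]; field_simp; ring
    · simp [hj]; ring
  have all (s : Finset (Fin n)) : F w ≤ F (s.piecewise z w) := by
    induction s using Finset.induction_on with
    | empty => simp
    | insert i s hi ih =>
      rw [Finset.piecewise_insert]
      refine ih.trans (step _ _ _ ?_)
      rw [Finset.piecewise_eq_of_notMem _ _ _ hi]
      exact hzw i
  simpa using all Finset.univ

/-- The difference `b (r⁴ - q⁴)` equals `τ B` with `B = b (r + q)² (r² + q²)`, and `τ B ≤ τ² + B² /
4`. The Jacobian gain absorbs `τ²`, and `B² / 4 ≤ 8 b² (r⁸ + q⁸)` is the source of the constant 8.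
-/
theorem exp_mul_le_sq_mean {b r q : ℝ} (hr : 0 < r) (hq : 0 < q) :
    Real.exp (b * (r ^ 2) ^ 2 - 8 * b ^ 2 * (r ^ 2) ^ 4) * r *
      (Real.exp (-b * (q ^ 2) ^ 2 - 8 * (-b) ^ 2 * (q ^ 2) ^ 4) * q) ≤ ((r + q) / 2) ^ 2 := by
  have hs : 0 < r + q := by positivity
  set τ := ((r - q) / (r + q)) with hτ
  have hd : r - q = τ * (r + q) := by rw [hτ]; field_simp
  have h1 : r * q = ((r + q) / 2) ^ 2 * (1 - τ ^ 2) := by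
    rw [mul_sub, ← mul_pow, mul_comm _ τ, ← mul_div_assoc, ← hd]; ring
  have h2 : 1 - τ ^ 2 ≤ Real.exp (-τ ^ 2) := by
    have := Real.add_one_le_exp (-τ ^ 2); linarith
  have h3 : b * (r ^ 2) ^ 2 - 8 * b ^ 2 * (r ^ 2) ^ 4 +
      (-b * (q ^ 2) ^ 2 - 8 * (-b) ^ 2 * (q ^ 2) ^ 4) ≤ τ ^ 2 := by
    have e1 : b * (r ^ 2) ^ 2 - b * (q ^ 2) ^ 2 = τ * (b * ((r + q) ^ 2 * (r ^ 2 + q ^ 2))) := by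
      calc _ = (r - q) * (b * ((r + q) * (r ^ 2 + q ^ 2))) := by ring
        _ = _ := by rw [hd]; ring
    have e2 : (r + q) ^ 2 * (r ^ 2 + q ^ 2) ≤ 2 * (r ^ 2 + q ^ 2) ^ 2 := by
      have : 0 ≤ (r - q) ^ 2 * (r ^ 2 + q ^ 2) := by positivity
      nlinarith
    have e3 : ((r + q) ^ 2 * (r ^ 2 + q ^ 2)) ^ 2 ≤ 4 * (r ^ 2 + q ^ 2) ^ 4 := by
      calc _ ≤ (2 * (r ^ 2 + q ^ 2) ^ 2) ^ 2 := by gcongr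
        _ = _ := by ring
    have e4 : (r ^ 2 + q ^ 2) ^ 4 ≤ 8 * ((r ^ 2) ^ 4 + (q ^ 2) ^ 4) := by
      have := add_pow_le (sq_nonneg r) (sq_nonneg q) 4
      norm_num at this ⊢
      linarith
    have e5 : τ * (b * ((r + q) ^ 2 * (r ^ 2 + q ^ 2))) ≤
        τ ^ 2 + b ^ 2 * ((r + q) ^ 2 * (r ^ 2 + q ^ 2)) ^ 2 / 4 := by
      nlinarith [sq_nonneg (τ - b * ((r + q) ^ 2 * (r ^ 2 + q ^ 2)) / 2)]
    have e6 : b ^ 2 * ((r + q) ^ 2 * (r ^ 2 + q ^ 2)) ^ 2 ≤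
        b ^ 2 * (4 * (8 * ((r ^ 2) ^ 4 + (q ^ 2) ^ 4))) := by
      gcongr; linarith
    linarith
  calc _ = Real.exp (b * (r ^ 2) ^ 2 - 8 * b ^ 2 * (r ^ 2) ^ 4 +
      (-b * (q ^ 2) ^ 2 - 8 * (-b) ^ 2 * (q ^ 2) ^ 4)) * (r * q) := by rw [Real.exp_add]; ring
    _ ≤ Real.exp (τ ^ 2) * (((r + q) / 2) ^ 2 * Real.exp (-τ ^ 2)) := by
      rw [h1]
      have : 0 ≤ 1 - τ ^ 2 := by
        by_contra hneg
        have : r * q < 0 := by rw [h1]; exact mul_neg_of_pos_of_neg (by positivity) (by linarith)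
        exact absurd this (not_lt.2 (by positivity))
      gcongr
    _ = _ := by rw [mul_left_comm, ← Real.exp_add]; simp

/-- The exponential tilt `exp (∑ bᵢ xᵢ² - 8 bᵢ² xᵢ⁴)`. -/
noncomputable def quarticTilt {n : ℕ} (b x : Fin n → ℝ) : ℝ :=
  Real.exp (∑ i, (b i * x i ^ 2 - 8 * b i ^ 2 * x i ^ 4))

theorem continuous_quarticTilt {n : ℕ} (b : Fin n → ℝ) : Continuous (quarticTilt b) := by
  unfold quarticTilt; fun_prop

theorem quarticTilt_abs {n : ℕ} (b x : Fin n → ℝ) : quarticTilt b |x| = quarticTilt b x := by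
  have h4 (y : ℝ) : |y| ^ 4 = y ^ 4 := (by decide : Even 4).pow_abs y
  simp [quarticTilt, h4]

theorem quarticTilt_mul_le {n : ℕ} (b : Fin n → ℝ) {r q : Fin n → ℝ} (hr : ∀ i, 0 < r i)
    (hq : ∀ i, 0 < q i) :
    ENNReal.ofReal (quarticTilt b fun i => r i ^ 2) * (∏ i, ENNReal.ofReal (r i)) *
      (ENNReal.ofReal (quarticTilt (-b) fun i => q i ^ 2) * ∏ i, ENNReal.ofReal (q i)) ≤
      (∏ i, ENNReal.ofReal ((r i + q i) / 2)) ^ 2 := by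
  have e (b r : Fin n → ℝ) (hr : ∀ i, 0 < r i) :
      ENNReal.ofReal (quarticTilt b fun i => r i ^ 2) * (∏ i, ENNReal.ofReal (r i)) =
      ∏ i, ENNReal.ofReal (Real.exp (b i * (r i ^ 2) ^ 2 - 8 * b i ^ 2 * (r i ^ 2) ^ 4) * r i) := by
    rw [quarticTilt, Real.exp_sum, ENNReal.ofReal_prod_of_nonneg (fun i _ => (Real.exp_pos _).le),
      ← Finset.prod_mul_distrib]
    refine Finset.prod_congr rfl fun i _ => ?_
    rw [ENNReal.ofReal_mul (Real.exp_pos _).le]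
  rw [e b r hr, e (-b) q hq, ← Finset.prod_mul_distrib, ← Finset.prod_pow]
  refine Finset.prod_le_prod' fun i _ => ?_
  have h1 := (hr i).le
  have h2 := (hq i).le
  rw [← ENNReal.ofReal_mul (by positivity), ← ENNReal.ofReal_pow (by positivity)]
  exact ENNReal.ofReal_le_ofReal (exp_mul_le_sq_mean (hr i) (hq i))

theorem lintegral_quarticTilt_mul_le {n : ℕ} {F : (Fin n → ℝ) → ℝ≥0∞} (hFm : Measurable F)
    (hF : ∀ x y : Fin n → ℝ, ∀ t : ℝ, 0 < t → t < 1 →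
      F x ^ t * F y ^ (1 - t) ≤ F (t • x + (1 - t) • y))
    (hFa : ∀ x, F |x| = F x) (b : Fin n → ℝ) :
    (∫⁻ x, ENNReal.ofReal (quarticTilt b x) * F x) *
      (∫⁻ x, ENNReal.ofReal (quarticTilt (-b) x) * F x) ≤ (∫⁻ x, F x) ^ 2 := by
  have hm (b : Fin n → ℝ) : Measurable fun x => ENNReal.ofReal (quarticTilt b x) * F x :=
    (continuous_quarticTilt b).measurable.ennreal_ofReal.mul hFm
  refine prekopa_leindler_pi_sq (hm b) (hm (-b)) hFm (fun x => by rw [quarticTilt_abs, hFa])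
    (fun x => by rw [quarticTilt_abs, hFa]) hFa fun r q hr hq => ?_
  have hmid (x y : Fin n → ℝ) : F x * F y ≤ F ((1 / 2 : ℝ) • x + (1 / 2 : ℝ) • y) ^ 2 := by
    have h := hF x y (1 / 2) (by norm_num) (by norm_num)
    rw [show (1 : ℝ) - 1 / 2 = 1 / 2 by norm_num] at h
    have hsq (u : ℝ≥0∞) : (u ^ (1 / 2 : ℝ)) ^ 2 = u := by
      rw [← ENNReal.rpow_natCast, ← ENNReal.rpow_mul]; norm_num
    calc F x * F y = (F x ^ (1 / 2 : ℝ) * F y ^ (1 / 2 : ℝ)) ^ 2 := by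
          rw [mul_pow, hsq, hsq]
      _ ≤ _ := by gcongr
  -- The square-root mean is coordinatewise below the arithmetic mean.
  have hmono : F ((1 / 2 : ℝ) • (fun i => r i ^ 2) + (1 / 2 : ℝ) • fun i => q i ^ 2) ≤
      F fun i => ((r i + q i) / 2) ^ 2 := by
    refine antitone_abs_of_logConcave hF hFa fun i => ?_
    rw [abs_of_nonneg (by positivity)]
    simp only [Pi.add_apply, Pi.smul_apply, smul_eq_mul]
    nlinarith [sq_nonneg (r i - q i)]
  calc _ = ENNReal.ofReal (quarticTilt b fun i => r i ^ 2) * (∏ i, ENNReal.ofReal (r i)) *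
      (ENNReal.ofReal (quarticTilt (-b) fun i => q i ^ 2) * ∏ i, ENNReal.ofReal (q i)) *
        (F (fun i => r i ^ 2) * F fun i => q i ^ 2) := by ring
    _ ≤ (∏ i, ENNReal.ofReal ((r i + q i) / 2)) ^ 2 *
        F (fun i => ((r i + q i) / 2) ^ 2) ^ 2 := by
      refine mul_le_mul' (quarticTilt_mul_le b hr hq) ((hmid _ _).trans ?_)
      gcongr
    _ = _ := by ring

/-! ### From functions to measures by averaging over small balls -/

/-- Tonelli and the substitution `x = y + δ v`. The factor `δ ^ n` will cancel between the two sides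
of the tilted inequality. -/
theorem lintegral_mul_measure_closedBall {n : ℕ} (μ : Measure (Fin n → ℝ)) [SFinite μ]
    {G : (Fin n → ℝ) → ℝ≥0∞} (hG : Measurable G) {δ : ℝ} (hδ : 0 < δ) :
    ∫⁻ x, G x * μ (Metric.closedBall x δ) = ENNReal.ofReal (δ ^ n) *
      ∫⁻ y, (∫⁻ v in Metric.closedBall (0 : Fin n → ℝ) 1, G (y + δ • v)) ∂μ := by
  have hK : MeasurableSet {p : (Fin n → ℝ) × (Fin n → ℝ) | dist p.2 p.1 ≤ δ} :=
    measurableSet_le (by fun_prop) measurable_const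
  have h1 : ∫⁻ x, G x * μ (Metric.closedBall x δ) =
      ∫⁻ x, ∫⁻ y, {p : (Fin n → ℝ) × (Fin n → ℝ) | dist p.2 p.1 ≤ δ}.indicator
        (fun p => G p.1) (x, y) ∂μ := by
    refine lintegral_congr fun x => ?_
    rw [← lintegral_indicator_const Metric.isClosed_closedBall.measurableSet]
    rfl
  rw [h1, lintegral_lintegral_swap (f := fun x y =>
      {p : (Fin n → ℝ) × (Fin n → ℝ) | dist p.2 p.1 ≤ δ}.indicator (fun p => G p.1) (x, y))
    ((hG.comp measurable_fst).indicator hK).aemeasurable, ← lintegral_const_mul']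
  swap
  · simp
  refine lintegral_congr fun y => ?_
  set u : (Fin n → ℝ) → ℝ≥0∞ := (Metric.closedBall y δ).indicator G with hu
  have hum : Measurable u := hG.indicator Metric.isClosed_closedBall.measurableSet
  have h2 : ∀ x, {p : (Fin n → ℝ) × (Fin n → ℝ) | dist p.2 p.1 ≤ δ}.indicator
      (fun p => G p.1) (x, y) = u x := by
    intro x
    simp only [hu, Set.indicator, Metric.mem_closedBall, Set.mem_ofPred_eq, dist_comm]
  have h3 : ∫⁻ v in Metric.closedBall (0 : Fin n → ℝ) 1, G (y + δ • v) = ∫⁻ v, u (y + δ • v) := by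
    rw [← lintegral_indicator Metric.isClosed_closedBall.measurableSet]
    refine lintegral_congr fun v => ?_
    have : ‖δ • v‖ ≤ δ ↔ ‖v‖ ≤ 1 := by
      rw [norm_smul, Real.norm_of_nonneg hδ.le, mul_le_iff_le_one_right hδ]
    simp only [hu, Set.indicator, Metric.mem_closedBall, dist_zero_right, dist_self_add_left, this]
  have h4 : ∫⁻ v, u (y + δ • v) = ENNReal.ofReal ((δ ^ n)⁻¹) * ∫⁻ w, u w := by
    have hmap := Measure.map_addHaar_smul (volume : Measure (Fin n → ℝ)) hδ.ne'
    rw [← lintegral_map (f := fun w => u (y + w)) (g := fun v => δ • v) (by fun_prop) (by fun_prop),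
      hmap, lintegral_smul_measure, lintegral_add_left_eq_self, smul_eq_mul]
    congr 2
    rw [abs_of_pos (by positivity)]
    simp
  rw [h3, h4, ← mul_assoc, ← ENNReal.ofReal_mul (by positivity), mul_inv_cancel₀ (by positivity)]
  simp [h2]

theorem lintegral_quarticTilt_mul_le_one {n : ℕ} (μ : Measure (Fin n → ℝ)) [IsProbabilityMeasure μ]
    (hμ : ∀ δ : ℝ, 0 < δ → ∀ x y : Fin n → ℝ, ∀ t : ℝ, 0 < t → t < 1 →
      μ (Metric.closedBall x δ) ^ t * μ (Metric.closedBall y δ) ^ (1 - t) ≤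
        μ (Metric.closedBall (t • x + (1 - t) • y) δ))
    (hμa : ∀ δ : ℝ, ∀ x, μ (Metric.closedBall |x| δ) = μ (Metric.closedBall x δ))
    (b : Fin n → ℝ) :
    (∫⁻ x, ENNReal.ofReal (quarticTilt b x) ∂μ) *
      (∫⁻ x, ENNReal.ofReal (quarticTilt (-b) x) ∂μ) ≤ 1 := by
  set κ : ℝ≥0∞ := volume (Metric.closedBall (0 : Fin n → ℝ) 1) with hκ
  have hκ0 : κ ≠ 0 := (Metric.measure_closedBall_pos _ _ one_pos).ne'
  have hκt : κ ≠ ∞ := measure_closedBall_lt_top.ne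
  set J : (Fin n → ℝ) → ℝ → ℝ≥0∞ := fun b δ => ∫⁻ y, (∫⁻ v in Metric.closedBall (0 : Fin n → ℝ) 1,
    ENNReal.ofReal (quarticTilt b (y + δ • v))) ∂μ with hJ
  have hJle (δ : ℝ) (hδ : 0 < δ) : J b δ * J (-b) δ ≤ κ ^ 2 := by
    have hFm : Measurable fun x => μ (Metric.closedBall x δ) :=
      measurable_measure_prodMk_left (s := {p : (Fin n → ℝ) × (Fin n → ℝ) | dist p.2 p.1 ≤ δ})
        (measurableSet_le (by fun_prop) measurable_const)
    have h := lintegral_quarticTilt_mul_le hFm (hμ δ hδ) (hμa δ) b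
    have h1 := lintegral_mul_measure_closedBall μ (G := fun _ => 1) measurable_const hδ
    simp only [one_mul, lintegral_const, Measure.restrict_apply_univ, measure_univ, mul_one] at h1
    rw [h1, lintegral_mul_measure_closedBall μ
      (continuous_quarticTilt b).measurable.ennreal_ofReal hδ, lintegral_mul_measure_closedBall μ
      (continuous_quarticTilt (-b)).measurable.ennreal_ofReal hδ, mul_mul_mul_comm, ← sq,
      mul_pow] at h
    refine (ENNReal.mul_le_mul_iff_right (a := ENNReal.ofReal (δ ^ n) ^ 2) ?_ ?_).1 h
    · have : 0 < δ ^ n := by positivity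
      simpa using this
    · simp
  have hlim : Filter.Tendsto (fun k : ℕ => (1 : ℝ) / (k + 1)) Filter.atTop (nhds 0) :=
    tendsto_one_div_add_atTop_nhds_zero_nat
  -- Only upper bounds on the limiting integrals are needed, so Fatou suffices and no domination is
  -- required.
  have hfatou (b : Fin n → ℝ) : κ * (∫⁻ x, ENNReal.ofReal (quarticTilt b x) ∂μ) ≤
      Filter.liminf (fun k : ℕ => J b (1 / (k + 1))) Filter.atTop := by
    have hc (δ : ℝ) : Measurable fun p : (Fin n → ℝ) × (Fin n → ℝ) =>
        ENNReal.ofReal (quarticTilt b (p.1 + δ • p.2)) :=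
      ((continuous_quarticTilt b).comp (by fun_prop)).measurable.ennreal_ofReal
    have hJ' (δ : ℝ) : J b δ = ∫⁻ p, ENNReal.ofReal (quarticTilt b (p.1 + δ • p.2))
        ∂(μ.prod (volume.restrict (Metric.closedBall (0 : Fin n → ℝ) 1))) := by
      rw [lintegral_prod _ (hc δ).aemeasurable]
    have h0 : κ * (∫⁻ x, ENNReal.ofReal (quarticTilt b x) ∂μ) =
        ∫⁻ p, ENNReal.ofReal (quarticTilt b p.1)
        ∂(μ.prod (volume.restrict (Metric.closedBall (0 : Fin n → ℝ) 1))) := by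
      have hm : Measurable fun p : (Fin n → ℝ) × (Fin n → ℝ) =>
          ENNReal.ofReal (quarticTilt b p.1) :=
        ((continuous_quarticTilt b).comp continuous_fst).measurable.ennreal_ofReal
      rw [lintegral_prod _ hm.aemeasurable]
      simp only [lintegral_const, Measure.restrict_apply_univ]
      rw [lintegral_mul_const _ (continuous_quarticTilt b).measurable.ennreal_ofReal, mul_comm]
    simp_rw [hJ']
    rw [h0]
    refine le_trans (le_of_eq ?_) (lintegral_liminf_le fun k => hc _)
    refine lintegral_congr fun p => ?_
    refine (Filter.Tendsto.liminf_eq ?_).symm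
    refine (ENNReal.continuous_ofReal.tendsto _).comp ?_
    refine ((continuous_quarticTilt b).tendsto _).comp ?_
    simpa using (tendsto_const_nhds (x := p.1)).add (hlim.smul_const p.2)
  have hfin : (κ * ∫⁻ x, ENNReal.ofReal (quarticTilt b x) ∂μ) *
      (κ * ∫⁻ x, ENNReal.ofReal (quarticTilt (-b) x) ∂μ) ≤ κ ^ 2 := by
    refine (mul_le_mul' (hfatou b) (hfatou (-b))).trans (ENNReal.le_liminf_mul.trans ?_)
    refine Filter.liminf_le_of_le (by isBoundedDefault) fun c hc => ?_
    obtain ⟨k, hk⟩ := hc.exists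
    exact hk.trans (hJle _ (by positivity))
  rw [mul_mul_mul_comm, ← sq] at hfin
  exact (ENNReal.mul_le_mul_iff_right (pow_ne_zero 2 hκ0) (ENNReal.pow_ne_top hκt)).1
    (by simpa using hfin)

/-! ### From exponential integrals to variance -/

theorem tendsto_exp_sub_one_sub_div_sq {s : ℕ → ℝ} (hs : Filter.Tendsto s Filter.atTop (nhds 0))
    (hs0 : ∀ k, s k ≠ 0) (w c : ℝ) :
    Filter.Tendsto (fun k => (Real.exp (s k * w - s k ^ 2 * c) - 1 - (s k * w - s k ^ 2 * c))
      / s k ^ 2) Filter.atTop (nhds (w ^ 2 / 2)) := by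
  have h1 : Filter.Tendsto (fun k => w - s k * c) Filter.atTop (nhds w) := by
    simpa using tendsto_const_nhds.sub (hs.mul_const c)
  have hu : Filter.Tendsto (fun k => s k * (w - s k * c)) Filter.atTop (nhds 0) := by
    simpa using hs.mul h1
  have h2 : Filter.Tendsto (fun k => (w - s k * c) ^ 2 / 2) Filter.atTop (nhds (w ^ 2 / 2)) :=
    (h1.pow 2).div_const 2
  have h3 : Filter.Tendsto (fun k => |s k| * |w - s k * c| ^ 3) Filter.atTop (nhds 0) := by
    simpa using hs.abs.mul (h1.abs.pow 3)
  have h4 := squeeze_zero_norm' (f := fun k => (Real.exp (s k * w - s k ^ 2 * c) - 1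
    - (s k * w - s k ^ 2 * c)) / s k ^ 2 - (w - s k * c) ^ 2 / 2) ?_ h3
  · simpa using h4.add h2
  have hev : ∀ᶠ k in Filter.atTop, |s k * (w - s k * c)| ≤ 1 := by
    have := hu.abs
    rw [abs_zero] at this
    exact (this.eventually (gt_mem_nhds one_pos)).mono fun k hk => hk.le
  filter_upwards [hev] with k hk
  have hb := Real.exp_bound hk (n := 3) (by norm_num)
  simp only [Finset.sum_range_succ, Finset.sum_range_zero, Nat.factorial] at hb
  norm_num at hb
  have hs2 : 0 < s k ^ 2 := by have := hs0 k; positivity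
  have e : (Real.exp (s k * w - s k ^ 2 * c) - 1 - (s k * w - s k ^ 2 * c)) / s k ^ 2
      - (w - s k * c) ^ 2 / 2 = (Real.exp (s k * (w - s k * c)) - (1 + s k * (w - s k * c) +
        (s k * (w - s k * c)) ^ 2 / 2)) / s k ^ 2 := by
    rw [show s k * w - s k ^ 2 * c = s k * (w - s k * c) by ring]
    field_simp [hs0 k]
    ring
  rw [e, Real.norm_eq_abs, abs_div, abs_of_pos hs2, div_le_iff₀ hs2]
  refine hb.trans ?_
  rw [mul_pow, ← sq_abs (s k)]
  have : 0 ≤ |s k| ^ 3 * |w - s k * c| ^ 3 := by positivity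
  nlinarith

/-- With `u = s W - s² K`, the bound `∫ exp u ≤ 1` gives `∫ (exp u - 1 - u) ≤ -∫ u = s² ∫ K`, since
`W` is centred. The integrand is non-negative, which prepares for Fatou. -/
theorem lintegral_exp_sub_one_sub_le {Ω : Type*} [MeasurableSpace Ω] (μ : Measure Ω)
    [IsProbabilityMeasure μ] {W K : Ω → ℝ} (hW : Integrable W μ) (hK : Integrable K μ)
    (hW0 : ∫ x, W x ∂μ = 0) {s : ℝ} (hs : s ≠ 0)
    (h : ∫⁻ x, ENNReal.ofReal (Real.exp (s * W x - s ^ 2 * K x)) ∂μ ≤ 1) :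
    ∫⁻ x, ENNReal.ofReal ((Real.exp (s * W x - s ^ 2 * K x) - 1 - (s * W x - s ^ 2 * K x))
      / s ^ 2) ∂μ ≤ ENNReal.ofReal (∫ x, K x ∂μ) := by
  have hu : Integrable (fun x => s * W x - s ^ 2 * K x) μ := (hW.const_mul s).sub (hK.const_mul _)
  have he : Integrable (fun x => Real.exp (s * W x - s ^ 2 * K x)) μ := by
    refine ⟨Real.continuous_exp.comp_aestronglyMeasurable hu.aestronglyMeasurable, ?_⟩
    rw [hasFiniteIntegral_iff_ofReal (Filter.Eventually.of_forall fun x => (Real.exp_pos _).le)]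
    exact h.trans_lt ENNReal.one_lt_top
  have he1 : ∫ x, Real.exp (s * W x - s ^ 2 * K x) ∂μ ≤ 1 := by
    rw [integral_eq_lintegral_of_nonneg_ae (Filter.Eventually.of_forall fun x => (Real.exp_pos _).le)
      he.aestronglyMeasurable]
    exact ENNReal.toReal_le_of_le_ofReal zero_le_one (by simpa using h)
  have hes : Integrable (fun x => Real.exp (s * W x - s ^ 2 * K x) - 1) μ :=
    he.sub (integrable_const _)
  have hq : Integrable (fun x => (Real.exp (s * W x - s ^ 2 * K x) - 1
      - (s * W x - s ^ 2 * K x)) / s ^ 2) μ :=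
    (hes.sub hu).div_const _
  rw [← ofReal_integral_eq_lintegral_ofReal hq (Filter.Eventually.of_forall fun x => ?_)]
  · refine ENNReal.ofReal_le_ofReal ?_
    have hs2 : 0 < s ^ 2 := by positivity
    rw [integral_div, integral_sub hes hu,
      integral_sub he (integrable_const _), integral_sub (hW.const_mul s) (hK.const_mul _),
      integral_const_mul, integral_const_mul, hW0, div_le_iff₀ hs2]
    simp
    linarith
  · have := Real.add_one_le_exp (s * W x - s ^ 2 * K x)
    have : 0 ≤ Real.exp (s * W x - s ^ 2 * K x) - 1 - (s * W x - s ^ 2 * K x) := by linarith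
    simp only [Pi.zero_apply]
    positivity

/-- The variance of `V` is controlled by `K` when the exponential moments of `s V - s² K` behave
as for a Gaussian family. -/
theorem evariance_le_of_lintegral_exp {Ω : Type*} [MeasurableSpace Ω] (μ : Measure Ω)
    [IsProbabilityMeasure μ] {V K : Ω → ℝ} (hV : Integrable V μ) (hK : Integrable K μ)
    (h : ∀ s : ℝ, (∫⁻ x, ENNReal.ofReal (Real.exp (s * V x - s ^ 2 * K x)) ∂μ) *
      (∫⁻ x, ENNReal.ofReal (Real.exp (-s * V x - s ^ 2 * K x)) ∂μ) ≤ 1) :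
    evariance V μ ≤ 2 * ENNReal.ofReal (∫ x, K x ∂μ) := by
  set m := ∫ x, V x ∂μ with hm
  set W : Ω → ℝ := fun x => V x - m with hWdef
  have hW : Integrable W μ := hV.sub (integrable_const _)
  have hW0 : ∫ x, W x ∂μ = 0 := by
    rw [integral_sub hV (integrable_const _)]; simp [hm]
  have shift (s : ℝ) : ∫⁻ x, ENNReal.ofReal (Real.exp (s * W x - s ^ 2 * K x)) ∂μ =
      ENNReal.ofReal (Real.exp (-(s * m))) *
        ∫⁻ x, ENNReal.ofReal (Real.exp (s * V x - s ^ 2 * K x)) ∂μ := by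
    rw [← lintegral_const_mul' _ _ (by simp)]
    refine lintegral_congr fun x => ?_
    rw [← ENNReal.ofReal_mul (Real.exp_pos _).le, ← Real.exp_add]
    congr 2
    simp only [hWdef]; ring
  -- Centring contributes `exp (-s m)` and `exp (s m)`, which cancel in the product.
  have hprod (s : ℝ) : (∫⁻ x, ENNReal.ofReal (Real.exp (s * W x - s ^ 2 * K x)) ∂μ) *
      (∫⁻ x, ENNReal.ofReal (Real.exp (-s * W x - (-s) ^ 2 * K x)) ∂μ) ≤ 1 := by
    rw [shift s, shift (-s), mul_mul_mul_comm, ← ENNReal.ofReal_mul (Real.exp_pos _).le,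
      ← Real.exp_add]
    simpa using h s
  -- Two factors with product at most 1 cannot both exceed 1, so one of the two signs works. The
  -- sign may vary with `k`, which is harmless for a second-order limit.
  have hsign (k : ℕ) : ∃ s : ℝ, |s| = 1 / ((k : ℝ) + 1) ∧
      ∫⁻ x, ENNReal.ofReal (Real.exp (s * W x - s ^ 2 * K x)) ∂μ ≤ 1 := by
    have hk : (0 : ℝ) < 1 / ((k : ℝ) + 1) := by positivity
    by_contra! hcon
    have h1 := hcon (1 / ((k : ℝ) + 1)) (abs_of_pos hk)
    have h2 := hcon (-(1 / ((k : ℝ) + 1))) (by rw [abs_neg, abs_of_pos hk])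
    exact absurd (hprod (1 / ((k : ℝ) + 1))) (not_le.2 (by simpa using ENNReal.mul_lt_mul h1 h2))
  choose s hs hs1 using hsign
  have hs0 (k : ℕ) : s k ≠ 0 := by
    rw [← abs_pos, hs k]; positivity
  have hlim : Filter.Tendsto s Filter.atTop (nhds 0) := by
    rw [tendsto_zero_iff_abs_tendsto_zero]
    refine Filter.Tendsto.congr (fun k => (hs k).symm) ?_
    exact tendsto_one_div_add_atTop_nhds_zero_nat
  -- Fatou also yields square integrability of `V`, which is not assumed.
  have hfat : ∫⁻ x, ENNReal.ofReal (W x ^ 2 / 2) ∂μ ≤ ENNReal.ofReal (∫ x, K x ∂μ) := by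
    calc ∫⁻ x, ENNReal.ofReal (W x ^ 2 / 2) ∂μ = ∫⁻ x, Filter.liminf (fun k =>
          ENNReal.ofReal ((Real.exp (s k * W x - s k ^ 2 * K x) - 1
            - (s k * W x - s k ^ 2 * K x)) / s k ^ 2)) Filter.atTop ∂μ := by
          refine lintegral_congr fun x => (Filter.Tendsto.liminf_eq ?_).symm
          exact (ENNReal.continuous_ofReal.tendsto _).comp
            (tendsto_exp_sub_one_sub_div_sq hlim hs0 (W x) (K x))
      _ ≤ _ := lintegral_liminf_le' fun k => by
          have := hW.aemeasurable
          have := hK.aemeasurable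
          fun_prop
      _ ≤ _ := by
          refine Filter.liminf_le_of_le (by isBoundedDefault) fun c hc => ?_
          obtain ⟨k, hk⟩ := hc.exists
          exact hk.trans (lintegral_exp_sub_one_sub_le μ hW hK hW0 (hs0 k) (hs1 k))
  rw [evariance_eq_lintegral_ofReal]
  calc ∫⁻ x, ENNReal.ofReal ((V x - m) ^ 2) ∂μ
      = 2 * ∫⁻ x, ENNReal.ofReal (W x ^ 2 / 2) ∂μ := by
        rw [← lintegral_const_mul' _ _ (by simp)]
        refine lintegral_congr fun x => ?_
        rw [← ENNReal.ofReal_ofNat 2, ← ENNReal.ofReal_mul (by norm_num)]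
        congr 1
        simp only [hWdef]; ring
    _ ≤ _ := by gcongr

/-- The weighted Poincaré inequality for diagonal quadratic forms of an unconditional log-concave
measure. -/
theorem evariance_sum_sq_le {n : ℕ} (μ : Measure (Fin n → ℝ)) [IsProbabilityMeasure μ]
    (hμ : ∀ δ : ℝ, 0 < δ → ∀ x y : Fin n → ℝ, ∀ t : ℝ, 0 < t → t < 1 →
      μ (Metric.closedBall x δ) ^ t * μ (Metric.closedBall y δ) ^ (1 - t) ≤
        μ (Metric.closedBall (t • x + (1 - t) • y) δ))
    (hμa : ∀ δ : ℝ, ∀ x, μ (Metric.closedBall |x| δ) = μ (Metric.closedBall x δ))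
    (h2 : ∀ i, Integrable (fun x : Fin n → ℝ => x i ^ 2) μ)
    (h4 : ∀ i, Integrable (fun x : Fin n → ℝ => x i ^ 4) μ) (a : Fin n → ℝ) :
    evariance (fun x => ∑ i, a i * x i ^ 2) μ ≤
      ENNReal.ofReal (∑ i, 16 * a i ^ 2 * ∫ x, x i ^ 4 ∂μ) := by
  have hV : Integrable (fun x : Fin n → ℝ => ∑ i, a i * x i ^ 2) μ :=
    integrable_finsetSum _ fun i _ => (h2 i).const_mul _
  have hK : Integrable (fun x : Fin n → ℝ => ∑ i, 8 * a i ^ 2 * x i ^ 4) μ :=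
    integrable_finsetSum _ fun i _ => (h4 i).const_mul _
  refine (evariance_le_of_lintegral_exp μ hV hK fun s => ?_).trans (le_of_eq ?_)
  · convert lintegral_quarticTilt_mul_le_one μ hμ hμa (s • a) using 4 with x x
    · simp only [quarticTilt, Finset.mul_sum, ← Finset.sum_sub_distrib, Pi.smul_apply, smul_eq_mul]
      congr 2; refine Finset.sum_congr rfl fun i _ => ?_; ring
    · simp only [quarticTilt, Finset.mul_sum, ← Finset.sum_sub_distrib, Pi.smul_apply, smul_eq_mul,
        Pi.neg_apply]
      congr 2; refine Finset.sum_congr rfl fun i _ => ?_; ring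
  · rw [integral_finsetSum _ fun i _ => (h4 i).const_mul _, ← ENNReal.ofReal_ofNat 2,
      ← ENNReal.ofReal_mul (by norm_num), Finset.mul_sum]
    congr 1
    refine Finset.sum_congr rfl fun i _ => ?_
    rw [integral_const_mul]; ring

/-! ### Unconditional log-concave measures: tails and fourth moments -/

/-- A measure on `ℝⁿ` that is log-concave and invariant under changes of signs of the
coordinates. -/
structure IsUnconditionalLogConcave {n : ℕ} (μ : Measure (Fin n → ℝ)) : Prop where
  logConcave : ∀ A B : Set (Fin n → ℝ), IsCompact A → IsCompact B → A.Nonempty → B.Nonempty →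
    ∀ t : ℝ, 0 < t → t < 1 → μ A ^ t * μ B ^ (1 - t) ≤ μ (t • A + (1 - t) • B)
  map_sign : ∀ ε : Fin n → ℝ, (∀ i, ε i = 1 ∨ ε i = -1) → μ.map (fun x i => ε i * x i) = μ

namespace IsUnconditionalLogConcave

variable {n : ℕ} {μ : Measure (Fin n → ℝ)}

theorem closedBall (h : IsUnconditionalLogConcave μ) {δ : ℝ} (hδ : 0 < δ) (x y : Fin n → ℝ)
    {t : ℝ} (ht0 : 0 < t) (ht1 : t < 1) :
    μ (Metric.closedBall x δ) ^ t * μ (Metric.closedBall y δ) ^ (1 - t) ≤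
      μ (Metric.closedBall (t • x + (1 - t) • y) δ) := by
  refine (h.logConcave _ _ (isCompact_closedBall _ _) (isCompact_closedBall _ _)
    (Metric.nonempty_closedBall.2 hδ.le) (Metric.nonempty_closedBall.2 hδ.le) t ht0 ht1).trans
    (measure_mono ?_)
  rintro _ ⟨_, ⟨u, hu, rfl⟩, _, ⟨v, hv, rfl⟩, rfl⟩
  rw [mem_closedBall_iff_norm] at hu hv ⊢
  have h1t : 0 ≤ 1 - t := by linarith
  calc ‖t • u + (1 - t) • v - (t • x + (1 - t) • y)‖ = ‖t • (u - x) + (1 - t) • (v - y)‖ := by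
        congr 1; module
    _ ≤ t * ‖u - x‖ + (1 - t) * ‖v - y‖ := by
        refine (norm_add_le _ _).trans (le_of_eq ?_)
        rw [norm_smul, norm_smul, Real.norm_of_nonneg ht0.le, Real.norm_of_nonneg h1t]
    _ ≤ t * δ + (1 - t) * δ := by gcongr
    _ = δ := by ring

theorem measurePreserving (h : IsUnconditionalLogConcave μ) {ε : Fin n → ℝ}
    (hε : ∀ i, ε i = 1 ∨ ε i = -1) : MeasurePreserving (fun x i => ε i * x i) μ μ :=
  ⟨by fun_prop, h.map_sign ε hε⟩

theorem closedBall_abs (h : IsUnconditionalLogConcave μ) (δ : ℝ) (x : Fin n → ℝ) :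
    μ (Metric.closedBall |x| δ) = μ (Metric.closedBall x δ) := by
  set ε : Fin n → ℝ := fun i => if 0 ≤ x i then 1 else -1 with hε
  have hε1 : ∀ i, ε i = 1 ∨ ε i = -1 := fun i => by by_cases hi : 0 ≤ x i <;> simp [hε, hi]
  rw [← (h.measurePreserving hε1).measure_preimage
    Metric.isClosed_closedBall.measurableSet.nullMeasurableSet]
  congr 1
  ext y
  rcases lt_or_ge δ 0 with hδ | hδ
  · simp [Metric.closedBall_eq_empty.2 hδ]
  simp only [Set.mem_preimage, Metric.mem_closedBall, dist_pi_le_iff hδ, Real.dist_eq, Pi.abs_apply]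
  refine forall_congr' fun i => ?_
  by_cases hi : 0 ≤ x i
  · simp [hε, hi, abs_of_nonneg]
  · rw [abs_of_neg (not_le.1 hi)]
    simp only [hε, hi, if_false]
    rw [← abs_neg]
    congr! 2
    ring

theorem integral_comp_sign (h : IsUnconditionalLogConcave μ) {ε : Fin n → ℝ}
    (hε : ∀ i, ε i = 1 ∨ ε i = -1) {f : (Fin n → ℝ) → ℝ} (hf : Measurable f) :
    ∫ x, f (fun i => ε i * x i) ∂μ = ∫ x, f x ∂μ := by
  conv_rhs => rw [← h.map_sign ε hε]
  rw [integral_map (h.measurePreserving hε).measurable.aemeasurable hf.aestronglyMeasurable]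

/-- Half-spaces are not compact; they are exhausted by their intersections with growing balls. -/
theorem halfspace [IsFiniteMeasure μ] (h : IsUnconditionalLogConcave μ) (i : Fin n) (r q : ℝ)
    {t : ℝ} (ht0 : 0 < t) (ht1 : t < 1) :
    μ {x | r ≤ x i} ^ t * μ {x | q ≤ x i} ^ (1 - t) ≤ μ {x | t * r + (1 - t) * q ≤ x i} := by
  have h1t : 0 < 1 - t := by linarith
  have hlim (r : ℝ) : Filter.Tendsto (fun R : ℕ => μ ({x | r ≤ x i} ∩ Metric.closedBall 0 R))
      Filter.atTop (nhds (μ {x | r ≤ x i})) := by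
    have hu : {x : Fin n → ℝ | r ≤ x i} = ⋃ R : ℕ, {x | r ≤ x i} ∩ Metric.closedBall 0 (R : ℝ) := by
      rw [← Set.inter_iUnion, Metric.iUnion_closedBall_nat, Set.inter_univ]
    conv => enter [3]; rw [hu]
    refine tendsto_measure_iUnion_atTop fun R S hRS => ?_
    exact Set.inter_subset_inter_right _ (Metric.closedBall_subset_closedBall (by exact_mod_cast hRS))
  have hcl (r : ℝ) (R : ℕ) : IsCompact ({x : Fin n → ℝ | r ≤ x i} ∩ Metric.closedBall 0 (R : ℝ)) :=
    (isCompact_closedBall _ _).inter_left (isClosed_le continuous_const (continuous_apply i))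
  have hne (r : ℝ) : ∀ᶠ R : ℕ in Filter.atTop,
      ({x : Fin n → ℝ | r ≤ x i} ∩ Metric.closedBall 0 (R : ℝ)).Nonempty := by
    obtain ⟨R₀, hR₀⟩ := exists_nat_ge |r|
    filter_upwards [Filter.eventually_ge_atTop R₀] with R hR
    refine ⟨Pi.single i r, by simp, ?_⟩
    rw [mem_closedBall_zero_iff, Pi.norm_single, Real.norm_eq_abs]
    exact hR₀.trans (by exact_mod_cast hR)
  have hpow (r : ℝ) {s : ℝ} := (ENNReal.continuous_rpow_const (y := s)).continuousAt.tendsto.comp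
    (hlim r)
  refine le_of_tendsto (ENNReal.Tendsto.mul (hpow r) (Or.inr ?_) (hpow q) (Or.inr ?_)) ?_
  · exact ENNReal.rpow_ne_top_of_nonneg h1t.le (measure_ne_top _ _)
  · exact ENNReal.rpow_ne_top_of_nonneg ht0.le (measure_ne_top _ _)
  · filter_upwards [hne r, hne q] with R hr hq
    refine (h.logConcave _ _ (hcl r R) (hcl q R) hr hq t ht0 ht1).trans (measure_mono ?_)
    rintro _ ⟨_, ⟨u, hu, rfl⟩, _, ⟨v, hv, rfl⟩, rfl⟩
    have hu1 : r ≤ u i := hu.1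
    have hv1 : q ≤ v i := hv.1
    simp only [Set.mem_ofPred_eq, Pi.add_apply, Pi.smul_apply, smul_eq_mul]
    gcongr

theorem measure_le_neg (h : IsUnconditionalLogConcave μ) (i : Fin n) (r : ℝ) :
    μ {x | x i ≤ -r} = μ {x | r ≤ x i} := by
  rw [← (h.measurePreserving (ε := fun _ => -1) (by simp)).measure_preimage
    (measurableSet_le measurable_const (measurable_pi_apply i)).nullMeasurableSet]
  congr 1
  ext x
  simp [le_neg]

theorem measure_le_abs (h : IsUnconditionalLogConcave μ) (i : Fin n) {r : ℝ} (hr : 0 < r) :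
    μ {x | r ≤ |x i|} = 2 * μ {x | r ≤ x i} := by
  have hu : {x : Fin n → ℝ | r ≤ |x i|} = {x | r ≤ x i} ∪ {x | x i ≤ -r} := by
    ext x
    simp only [Set.mem_ofPred_eq, Set.mem_union, le_abs, le_neg]
  rw [hu, measure_union, h.measure_le_neg, two_mul]
  · refine Set.disjoint_left.2 fun x hx hx' => ?_
    have h1 : r ≤ x i := hx
    have h2 : x i ≤ -r := hx'
    linarith
  · exact measurableSet_le (measurable_pi_apply i) measurable_const

/-- Log-concavity at `2 = (1 / m) (2 m) + (1 - 1 / m) 0` bounds the tail at `2 m` by an `m`-th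
power. Chebyshev gives `P(|xᵢ| ≥ 2) ≤ 1 / 4`, and symmetry gives mass at least `1 / 2` to `xᵢ ≥ 0`;
this half offsets the one-sidedness of the tail. -/
theorem measure_tail_le [IsProbabilityMeasure μ] (h : IsUnconditionalLogConcave μ) (i : Fin n)
    (h2 : ∫⁻ x, ENNReal.ofReal (x i ^ 2) ∂μ ≤ 1) (m : ℕ) :
    μ {x | 2 * (m : ℝ) ≤ |x i|} ≤ 2 * (1 / 4) ^ m := by
  have hhalf : 2⁻¹ ≤ μ {x | 0 ≤ x i} := by
    have h1 : (1 : ℝ≥0∞) ≤ 2 * μ {x | 0 ≤ x i} := by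
      rw [← measure_univ (μ := μ), two_mul]
      conv_rhs => enter [2]; rw [← h.measure_le_neg]
      refine (measure_mono fun x _ => ?_).trans (measure_union_le _ _)
      simpa using le_total 0 (x i)
    rw [ENNReal.inv_le_iff_le_mul (by simp) (by simp)]
    exact h1
  have hcheb : 2 * μ {x | 2 ≤ x i} ≤ 1 / 4 := by
    rw [← h.measure_le_abs i two_pos]
    have hm := mul_meas_ge_le_lintegral (μ := μ) (f := fun x => ENNReal.ofReal (x i ^ 2))
      (by fun_prop) 4
    have hs : {x : Fin n → ℝ | 2 ≤ |x i|} ⊆ {x | 4 ≤ ENNReal.ofReal (x i ^ 2)} := by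
      intro x (hx : 2 ≤ |x i|)
      simp only [Set.mem_ofPred_eq]
      rw [← ENNReal.ofReal_ofNat 4]
      refine ENNReal.ofReal_le_ofReal ?_
      rw [← sq_abs]; nlinarith
    rw [ENNReal.le_div_iff_mul_le (by simp) (by simp), mul_comm]
    exact (mul_le_mul_right (measure_mono hs) 4).trans (hm.trans h2)
  match m with
  | 0 => exact prob_le_one.trans (by simp)
  | 1 =>
    have := h.measure_le_abs i two_pos
    simp only [Nat.cast_one, mul_one, pow_one]
    rw [this]
    refine hcheb.trans ?_
    conv_lhs => rw [← one_mul (1 / 4 : ℝ≥0∞)]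
    gcongr
    norm_num
  | k + 2 =>
    set m := k + 2 with hm
    have hm0 : (0 : ℝ) < m := by positivity
    have hm1 : (1 : ℝ) < m := by rw [hm]; push_cast; linarith [(Nat.cast_nonneg k : (0 : ℝ) ≤ k)]
    have hkey := h.halfspace i (2 * m) 0 (t := 1 / m) (by positivity)
      (by rw [div_lt_one hm0]; exact hm1)
    rw [mul_zero, add_zero, show 1 / (m : ℝ) * (2 * m) = 2 by field_simp] at hkey
    have hT0 : 2⁻¹ ≤ μ {x | 0 ≤ x i} ^ (1 - 1 / (m : ℝ)) := by
      refine hhalf.trans ?_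
      conv_lhs => rw [← ENNReal.rpow_one (μ {x | 0 ≤ x i})]
      refine ENNReal.rpow_le_rpow_of_exponent_ge prob_le_one ?_
      have : 0 < 1 / (m : ℝ) := by positivity
      linarith
    have hle : μ {x | 2 * (m : ℝ) ≤ x i} ^ (1 / (m : ℝ)) ≤ 1 / 4 := by
      refine le_trans ?_ hcheb
      calc μ {x | 2 * (m : ℝ) ≤ x i} ^ (1 / (m : ℝ))
          = 2 * (μ {x | 2 * (m : ℝ) ≤ x i} ^ (1 / (m : ℝ)) * 2⁻¹) := by
            rw [mul_left_comm, ENNReal.mul_inv_cancel (by simp) (by simp), mul_one]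
        _ ≤ 2 * (μ {x | 2 * (m : ℝ) ≤ x i} ^ (1 / (m : ℝ)) *
              μ {x | 0 ≤ x i} ^ (1 - 1 / (m : ℝ))) := by gcongr
        _ ≤ _ := by gcongr
    rw [h.measure_le_abs i (by positivity)]
    gcongr
    calc μ {x | 2 * (m : ℝ) ≤ x i} = (μ {x | 2 * (m : ℝ) ≤ x i} ^ (1 / (m : ℝ))) ^ m := by
          rw [← ENNReal.rpow_natCast, ← ENNReal.rpow_mul, one_div_mul_cancel hm0.ne',
            ENNReal.rpow_one]
      _ ≤ _ := by gcongr

end IsUnconditionalLogConcave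

theorem summable_fourth_power_geometric :
    Summable fun m : ℕ => 32 * ((m : ℝ) + 1) ^ 4 * (1 / 4) ^ m := by
  have h := summable_pow_mul_geometric_of_norm_lt_one 4 (r := (1 / 4 : ℝ)) (by norm_num)
  have h1 := ((summable_nat_add_iff 1).2 h).mul_left 128
  refine h1.congr fun m => ?_
  push_cast
  ring

/-- A bound for the fourth moment of a symmetric log-concave random variable of variance one. -/
noncomputable def fourthMomentBound : ℝ := ∑' m : ℕ, 32 * ((m : ℝ) + 1) ^ 4 * (1 / 4) ^ m

theorem fourthMomentBound_nonneg : 0 ≤ fourthMomentBound := tsum_nonneg fun m => by positivity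

namespace IsUnconditionalLogConcave

variable {n : ℕ} {μ : Measure (Fin n → ℝ)} [IsProbabilityMeasure μ]

theorem lintegral_pow_four_le (h : IsUnconditionalLogConcave μ) (i : Fin n)
    (h2 : ∫⁻ x, ENNReal.ofReal (x i ^ 2) ∂μ ≤ 1) :
    ∫⁻ x, ENNReal.ofReal (x i ^ 4) ∂μ ≤ ENNReal.ofReal fourthMomentBound := by
  have hms (m : ℕ) : MeasurableSet {x : Fin n → ℝ | 2 * (m : ℝ) ≤ |x i|} :=
    measurableSet_le measurable_const (by fun_prop)
  calc ∫⁻ x, ENNReal.ofReal (x i ^ 4) ∂μ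
      ≤ ∫⁻ x, ∑' m : ℕ, {x : Fin n → ℝ | 2 * (m : ℝ) ≤ |x i|}.indicator
          (fun _ => ENNReal.ofReal (16 * ((m : ℝ) + 1) ^ 4)) x ∂μ := by
        refine lintegral_mono fun x => ?_
        -- The term of the slab `2 m ≤ |xᵢ| < 2 (m + 1)` alone dominates `xᵢ⁴`.
        set m := ⌊|x i| / 2⌋₊ with hm
        have h1 : 2 * (m : ℝ) ≤ |x i| := by
          have := Nat.floor_le (show 0 ≤ |x i| / 2 by positivity)
          linarith
        have h3 : |x i| ≤ 2 * ((m : ℝ) + 1) := by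
          have := Nat.lt_floor_add_one (|x i| / 2)
          linarith
        refine le_trans ?_ (ENNReal.le_tsum m)
        rw [Set.indicator_of_mem (by exact h1)]
        refine ENNReal.ofReal_le_ofReal ?_
        calc x i ^ 4 = |x i| ^ 4 := ((by decide : Even 4).pow_abs _).symm
          _ ≤ (2 * ((m : ℝ) + 1)) ^ 4 := by gcongr
          _ = _ := by ring
    _ = ∑' m : ℕ, ENNReal.ofReal (16 * ((m : ℝ) + 1) ^ 4) * μ {x | 2 * (m : ℝ) ≤ |x i|} := by
        rw [lintegral_tsum fun m => (measurable_const.indicator (hms m)).aemeasurable]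
        refine tsum_congr fun m => ?_
        rw [lintegral_indicator_const (hms m)]
    _ ≤ ∑' m : ℕ, ENNReal.ofReal (32 * ((m : ℝ) + 1) ^ 4 * (1 / 4) ^ m) := by
        refine ENNReal.tsum_le_tsum fun m => ?_
        calc _ ≤ ENNReal.ofReal (16 * ((m : ℝ) + 1) ^ 4) * (2 * (1 / 4) ^ m) := by
              gcongr; exact h.measure_tail_le i h2 m
          _ = ENNReal.ofReal (16 * ((m : ℝ) + 1) ^ 4 * (2 * (1 / 4) ^ m)) := by
              have e : (2 * (1 / 4) ^ m : ℝ≥0∞) = ENNReal.ofReal (2 * (1 / 4) ^ m) := by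
                rw [ENNReal.ofReal_mul (by norm_num), ENNReal.ofReal_pow (by norm_num),
                  ENNReal.ofReal_div_of_pos (by norm_num)]
                simp
              rw [e, ← ENNReal.ofReal_mul (by positivity)]
          _ = _ := by congr 1; ring
    _ = _ := by
        rw [fourthMomentBound, ENNReal.ofReal_tsum_of_nonneg (fun m => by positivity)
          summable_fourth_power_geometric]

theorem integrable_pow_four (h : IsUnconditionalLogConcave μ) (i : Fin n)
    (h2 : ∫⁻ x, ENNReal.ofReal (x i ^ 2) ∂μ ≤ 1) : Integrable (fun x => x i ^ 4) μ := by
  refine ⟨Measurable.aestronglyMeasurable (by fun_prop), ?_⟩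
  rw [hasFiniteIntegral_iff_ofReal (Filter.Eventually.of_forall fun x => by positivity)]
  exact (h.lintegral_pow_four_le i h2).trans_lt ENNReal.ofReal_lt_top

theorem integral_pow_four_le (h : IsUnconditionalLogConcave μ) (i : Fin n)
    (h2 : ∫⁻ x, ENNReal.ofReal (x i ^ 2) ∂μ ≤ 1) : ∫ x, x i ^ 4 ∂μ ≤ fourthMomentBound := by
  rw [integral_eq_lintegral_of_nonneg_ae (Filter.Eventually.of_forall fun x => by positivity)
    (Measurable.aestronglyMeasurable (by fun_prop))]
  exact ENNReal.toReal_le_of_le_ofReal fourthMomentBound_nonneg (h.lintegral_pow_four_le i h2)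

end IsUnconditionalLogConcave

/-! ### Off-diagonal forms and the full quadratic estimate -/

theorem abs_mul_four_le (a b c d : ℝ) : |a * b * c * d| ≤ (a ^ 4 + b ^ 4 + c ^ 4 + d ^ 4) / 4 := by
  rw [abs_le]
  constructor <;>
  nlinarith [sq_nonneg (a ^ 2 - b ^ 2), sq_nonneg (c ^ 2 - d ^ 2), sq_nonneg (a * b - c * d),
    sq_nonneg (a * b + c * d)]

theorem evariance_add_le {Ω : Type*} [MeasurableSpace Ω] {μ : Measure Ω} {f g : Ω → ℝ}
    (hf : Integrable f μ) (hg : Integrable g μ) :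
    evariance (fun x => f x + g x) μ ≤ 2 * evariance f μ + 2 * evariance g μ := by
  simp only [evariance_eq_lintegral_ofReal]
  rw [integral_add hf hg, ← lintegral_const_mul' _ _ (by simp),
    ← lintegral_const_mul' _ _ (by simp), ← lintegral_add_left']
  · refine lintegral_mono fun x => ?_
    rw [← ENNReal.ofReal_ofNat 2, ← ENNReal.ofReal_mul (by norm_num),
      ← ENNReal.ofReal_mul (by norm_num), ← ENNReal.ofReal_add (by positivity) (by positivity)]
    refine ENNReal.ofReal_le_ofReal ?_
    nlinarith [sq_nonneg ((f x - ∫ x, f x ∂μ) - (g x - ∫ x, g x ∂μ))]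
  · have := hf.aemeasurable
    fun_prop

/-- Each `(i, j)` meets only the two pairs `(i, j)` and `(j, i)`, and `|b i j * b k l| ≤ (b i j ^ 2
+ b k l ^ 2) / 2`; hence the factor `2 * M`. -/
theorem sum_sum_mul_le_of_pairing {n : ℕ} (b : Fin n → Fin n → ℝ) (hb : ∀ i, b i i = 0)
    {c : Fin n → Fin n → Fin n → Fin n → ℝ} {M : ℝ} (hM : ∀ i j k l, |c i j k l| ≤ M)
    (hc : ∀ i j k l, i ≠ j → k ≠ l → ¬(k = i ∧ l = j) → ¬(k = j ∧ l = i) → c i j k l = 0) :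
    ∑ i, ∑ j, ∑ k, ∑ l, b i j * b k l * c i j k l ≤ 2 * M * ∑ i, ∑ j, b i j ^ 2 := by
  have key (i j k l : Fin n) : b i j * b k l * c i j k l ≤
      (if k = i then if l = j then M * b i j ^ 2 else 0 else 0) +
      (if k = j then if l = i then M * ((b i j ^ 2 + b j i ^ 2) / 2) else 0 else 0) := by
    have hM0 : 0 ≤ M := (abs_nonneg _).trans (hM i j k l)
    have h1 : 0 ≤ (if k = i then if l = j then M * b i j ^ 2 else 0 else 0) := by
      split_ifs <;> positivity
    have h2 : 0 ≤ (if k = j then if l = i then M * ((b i j ^ 2 + b j i ^ 2) / 2) else 0 else 0) := by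
      split_ifs <;> positivity
    rcases eq_or_ne i j with rfl | hij
    · rw [hb, zero_mul, zero_mul]; positivity
    rcases eq_or_ne k l with rfl | hkl
    · rw [hb, mul_zero, zero_mul]; positivity
    have hgen : b i j * b k l * c i j k l ≤ M * ((b i j ^ 2 + b k l ^ 2) / 2) := by
      calc _ ≤ |b i j * b k l * c i j k l| := le_abs_self _
        _ = |c i j k l| * |b i j * b k l| := by rw [abs_mul, mul_comm]
        _ ≤ M * ((b i j ^ 2 + b k l ^ 2) / 2) := by
          refine mul_le_mul (hM i j k l) ?_ (abs_nonneg _) hM0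
          rw [abs_le]
          constructor <;> nlinarith [sq_nonneg (b i j - b k l), sq_nonneg (b i j + b k l)]
    by_cases h3 : k = i ∧ l = j
    · obtain ⟨rfl, rfl⟩ := h3
      simp only [if_true] at h2 ⊢
      linarith
    by_cases h4 : k = j ∧ l = i
    · obtain ⟨rfl, rfl⟩ := h4
      simp only [if_true] at h1 ⊢
      linarith
    rw [hc i j k l hij hkl h3 h4, mul_zero]
    positivity
  calc _ ≤ ∑ i, ∑ j, ∑ k, ∑ l,
      ((if k = i then if l = j then M * b i j ^ 2 else 0 else 0) +
      (if k = j then if l = i then M * ((b i j ^ 2 + b j i ^ 2) / 2) else 0 else 0)) := by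
        gcongr with i _ j _ k _ l _
        exact key i j k l
    _ = ∑ i, ∑ j, (M * b i j ^ 2 + M * ((b i j ^ 2 + b j i ^ 2) / 2)) := by
        refine Finset.sum_congr rfl fun i _ => Finset.sum_congr rfl fun j _ => ?_
        simp [Finset.sum_add_distrib]
    _ = _ := by
        have hcomm : ∑ i, ∑ j, b j i ^ 2 = ∑ i, ∑ j, b i j ^ 2 := Finset.sum_comm
        have e : ∀ i j, M * b i j ^ 2 + M * ((b i j ^ 2 + b j i ^ 2) / 2)
            = 3 / 2 * M * b i j ^ 2 + 1 / 2 * M * b j i ^ 2 := fun i j => by ring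
        simp_rw [e, Finset.sum_add_distrib, ← Finset.mul_sum]
        rw [hcomm]; ring

namespace IsUnconditionalLogConcave

variable {n : ℕ} {μ : Measure (Fin n → ℝ)}

theorem integral_mul_four_eq_zero (h : IsUnconditionalLogConcave μ) {i j k l : Fin n}
    (hij : i ≠ j) (hik : i ≠ k) (hil : i ≠ l) : ∫ x, x i * (x j * x k * x l) ∂μ = 0 := by
  have hε : ∀ p, (if p = i then (-1 : ℝ) else 1) = 1 ∨ (if p = i then (-1 : ℝ) else 1) = -1 := by
    intro p; by_cases hp : p = i <;> simp [hp]
  have hs := h.integral_comp_sign hε (f := fun x => x i * (x j * x k * x l)) (by fun_prop)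
  simp only [if_true, hij.symm, hik.symm, hil.symm, if_false, one_mul, neg_mul, integral_neg] at hs
  linarith

/-- Outside the two pairings, `i` or `j` occurs exactly once among the four indices, and flipping
the sign of that coordinate negates the integral. -/
theorem integral_mul_four_eq_zero_of_ne (h : IsUnconditionalLogConcave μ) (i j k l : Fin n)
    (hij : i ≠ j) (h1 : ¬(k = i ∧ l = j)) (h2 : ¬(k = j ∧ l = i)) :
    ∫ x, x i * x j * x k * x l ∂μ = 0 := by
  by_cases hk : k = i
  · have hl : l ≠ j := fun hl => h1 ⟨hk, hl⟩
    rw [← h.integral_mul_four_eq_zero hij.symm (by rw [hk]; exact hij.symm) hl.symm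
      (j := i) (k := k) (l := l)]
    exact integral_congr_ae (Filter.Eventually.of_forall fun x => by ring)
  by_cases hl : l = i
  · have hk' : k ≠ j := fun hk => h2 ⟨hk, hl⟩
    rw [← h.integral_mul_four_eq_zero hij.symm hk'.symm (by rw [hl]; exact hij.symm)
      (j := i) (k := k) (l := l)]
    exact integral_congr_ae (Filter.Eventually.of_forall fun x => by ring)
  · rw [← h.integral_mul_four_eq_zero hij (Ne.symm hk) (Ne.symm hl) (j := j) (k := k) (l := l)]
    exact integral_congr_ae (Filter.Eventually.of_forall fun x => by ring)

variable [IsProbabilityMeasure μ]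

theorem integrable_mul_four (h : IsUnconditionalLogConcave μ)
    (h2 : ∀ i, ∫⁻ x, ENNReal.ofReal (x i ^ 2) ∂μ ≤ 1) (i j k l : Fin n) :
    Integrable (fun x => x i * x j * x k * x l) μ := by
  have h4 := fun i => h.integrable_pow_four i (h2 i)
  refine Integrable.mono' ((((h4 i).add (h4 j)).add (h4 k)).add (h4 l) |>.div_const 4)
    (Measurable.aestronglyMeasurable (by fun_prop)) (Filter.Eventually.of_forall fun x => ?_)
  exact abs_mul_four_le _ _ _ _

theorem abs_integral_mul_four_le (h : IsUnconditionalLogConcave μ)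
    (h2 : ∀ i, ∫⁻ x, ENNReal.ofReal (x i ^ 2) ∂μ ≤ 1) (i j k l : Fin n) :
    |∫ x, x i * x j * x k * x l ∂μ| ≤ fourthMomentBound := by
  have h4 := fun i => h.integrable_pow_four i (h2 i)
  have hb := fun i => h.integral_pow_four_le i (h2 i)
  calc |∫ x, x i * x j * x k * x l ∂μ| ≤ ∫ x, |x i * x j * x k * x l| ∂μ :=
        abs_integral_le_integral_abs
    _ ≤ ∫ x, (x i ^ 4 + x j ^ 4 + x k ^ 4 + x l ^ 4) / 4 ∂μ := by
        refine integral_mono (h.integrable_mul_four h2 i j k l).abs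
          ((((h4 i).add (h4 j)).add (h4 k)).add (h4 l) |>.div_const 4) fun x => ?_
        exact abs_mul_four_le _ _ _ _
    _ = ((∫ x, x i ^ 4 ∂μ) + (∫ x, x j ^ 4 ∂μ) + (∫ x, x k ^ 4 ∂μ) + ∫ x, x l ^ 4 ∂μ) / 4 := by
        have hij : Integrable (fun x => x i ^ 4 + x j ^ 4) μ := (h4 i).add (h4 j)
        have hijk : Integrable (fun x => x i ^ 4 + x j ^ 4 + x k ^ 4) μ := hij.add (h4 k)
        rw [integral_div, integral_add hijk (h4 l), integral_add hij (h4 k),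
          integral_add (h4 i) (h4 j)]
    _ ≤ _ := by linarith [hb i, hb j, hb k, hb l]

theorem integral_offDiag_sq_le (h : IsUnconditionalLogConcave μ)
    (h2 : ∀ i, ∫⁻ x, ENNReal.ofReal (x i ^ 2) ∂μ ≤ 1) (b : Fin n → Fin n → ℝ)
    (hb : ∀ i, b i i = 0) :
    ∫ x, (∑ i, ∑ j, b i j * x i * x j) ^ 2 ∂μ ≤
      2 * fourthMomentBound * ∑ i, ∑ j, b i j ^ 2 := by
  have hint (i j k l : Fin n) :
      Integrable (fun x => b i j * b k l * (x i * x j * x k * x l)) μ :=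
    (h.integrable_mul_four h2 i j k l).const_mul _
  have e : ∀ x : Fin n → ℝ, (∑ i, ∑ j, b i j * x i * x j) ^ 2 =
      ∑ i, ∑ j, ∑ k, ∑ l, b i j * b k l * (x i * x j * x k * x l) := by
    intro x
    rw [sq, Finset.sum_mul]
    refine Finset.sum_congr rfl fun i _ => ?_
    rw [Finset.sum_mul]
    refine Finset.sum_congr rfl fun j _ => ?_
    rw [Finset.mul_sum]
    refine Finset.sum_congr rfl fun k _ => ?_
    rw [Finset.mul_sum]
    exact Finset.sum_congr rfl fun l _ => by ring
  have e2 : ∫ x, (∑ i, ∑ j, b i j * x i * x j) ^ 2 ∂μ =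
      ∑ i, ∑ j, ∑ k, ∑ l, b i j * b k l * ∫ x, x i * x j * x k * x l ∂μ := by
    simp_rw [e]
    rw [integral_finsetSum _ fun i _ => integrable_finsetSum _ fun j _ =>
      integrable_finsetSum _ fun k _ => integrable_finsetSum _ fun l _ => hint i j k l]
    refine Finset.sum_congr rfl fun i _ => ?_
    rw [integral_finsetSum _ fun j _ =>
      integrable_finsetSum _ fun k _ => integrable_finsetSum _ fun l _ => hint i j k l]
    refine Finset.sum_congr rfl fun j _ => ?_
    rw [integral_finsetSum _ fun k _ => integrable_finsetSum _ fun l _ => hint i j k l]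
    refine Finset.sum_congr rfl fun k _ => ?_
    rw [integral_finsetSum _ fun l _ => hint i j k l]
    exact Finset.sum_congr rfl fun l _ => integral_const_mul _ _
  rw [e2]
  exact sum_sum_mul_le_of_pairing b hb (h.abs_integral_mul_four_le h2)
    fun i j k l hij _ => h.integral_mul_four_eq_zero_of_ne i j k l hij

theorem memLp_mul (h : IsUnconditionalLogConcave μ)
    (h2 : ∀ i, ∫⁻ x, ENNReal.ofReal (x i ^ 2) ∂μ ≤ 1) (i j : Fin n) :
    MemLp (fun x => x i * x j) 2 μ := by
  rw [memLp_two_iff_integrable_sq (Measurable.aestronglyMeasurable (by fun_prop))]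
  refine (h.integrable_mul_four h2 i j i j).congr (Filter.Eventually.of_forall fun x => ?_)
  simp only; ring

/-- The second order correlation inequality for unconditional log-concave measures. -/
theorem evariance_quadratic_le (h : IsUnconditionalLogConcave μ)
    (h2 : ∀ i, ∫⁻ x, ENNReal.ofReal (x i ^ 2) ∂μ ≤ 1) (a : Fin n → Fin n → ℝ) :
    evariance (fun x => ∑ i, ∑ j, a i j * x i * x j) μ ≤
      ENNReal.ofReal (36 * fourthMomentBound) * ENNReal.ofReal (∑ i, ∑ j, a i j ^ 2) := by
  set M := fourthMomentBound with hM
  have hM0 : 0 ≤ M := fourthMomentBound_nonneg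
  set b : Fin n → Fin n → ℝ := fun i j => if i = j then 0 else a i j with hb
  have hsplit (x : Fin n → ℝ) : ∑ i, ∑ j, a i j * x i * x j =
      ∑ i, a i i * x i ^ 2 + ∑ i, ∑ j, b i j * x i * x j := by
    rw [← Finset.sum_add_distrib]
    refine Finset.sum_congr rfl fun i _ => ?_
    have : a i i * x i ^ 2 = ∑ j, if i = j then a i j * x i * x j else 0 := by
      simp; ring
    rw [this, ← Finset.sum_add_distrib]
    refine Finset.sum_congr rfl fun j _ => ?_
    by_cases hij : i = j <;> simp [hb, hij]
  have hoff : MemLp (fun x => ∑ i, ∑ j, b i j * x i * x j) 2 μ := by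
    refine memLp_finsetSum _ fun i _ => memLp_finsetSum _ fun j _ => ?_
    simpa only [mul_assoc] using (h.memLp_mul h2 i j).const_mul (b i j)
  have hsq (i : Fin n) : Integrable (fun x : Fin n → ℝ => x i ^ 2) μ := by
    simpa only [sq] using (h.memLp_mul h2 i i).integrable (by norm_num)
  have hdiag : Integrable (fun x : Fin n → ℝ => ∑ i, a i i * x i ^ 2) μ :=
    integrable_finsetSum _ fun i _ => (hsq i).const_mul _
  have hV1 : evariance (fun x : Fin n → ℝ => ∑ i, a i i * x i ^ 2) μ ≤
      ENNReal.ofReal (16 * M * ∑ i, ∑ j, a i j ^ 2) := by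
    refine (evariance_sum_sq_le μ (fun δ hδ x y t ht0 ht1 => h.closedBall hδ x y ht0 ht1)
      h.closedBall_abs hsq (fun i => h.integrable_pow_four i (h2 i)) fun i => a i i).trans ?_
    refine ENNReal.ofReal_le_ofReal ?_
    rw [Finset.mul_sum]
    refine Finset.sum_le_sum fun i _ => ?_
    calc 16 * a i i ^ 2 * ∫ x, x i ^ 4 ∂μ ≤ 16 * a i i ^ 2 * M := by
          gcongr; exact h.integral_pow_four_le i (h2 i)
      _ = 16 * M * a i i ^ 2 := by ring
      _ ≤ _ := by
          gcongr
          exact Finset.single_le_sum (f := fun j => a i j ^ 2) (fun j _ => sq_nonneg _)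
            (Finset.mem_univ i)
  have hV2 : evariance (fun x => ∑ i, ∑ j, b i j * x i * x j) μ ≤
      ENNReal.ofReal (2 * M * ∑ i, ∑ j, a i j ^ 2) := by
    rw [← ofReal_variance hoff]
    refine ENNReal.ofReal_le_ofReal ((variance_le_expectation_sq hoff.aestronglyMeasurable).trans
      ((h.integral_offDiag_sq_le h2 b (by simp [hb])).trans ?_))
    refine mul_le_mul_of_nonneg_left (Finset.sum_le_sum fun i _ => Finset.sum_le_sum fun j _ => ?_)
      (by positivity)
    by_cases hij : i = j
    · simp [hb, hij, sq_nonneg]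
    · simp [hb, hij]
  simp_rw [hsplit]
  -- The constant is `36 = 2 * 16 + 2 * 2`, from the diagonal and off-diagonal bounds.
  refine (evariance_add_le hdiag (hoff.integrable (by norm_num))).trans ?_
  have hS : 0 ≤ ∑ i, ∑ j, a i j ^ 2 := by positivity
  calc _ ≤ 2 * ENNReal.ofReal (16 * M * ∑ i, ∑ j, a i j ^ 2) +
        2 * ENNReal.ofReal (2 * M * ∑ i, ∑ j, a i j ^ 2) := by gcongr
    _ = _ := by
      rw [← mul_add, ← ENNReal.ofReal_add (by positivity) (by positivity),
        ← ENNReal.ofReal_ofNat 2, ← ENNReal.ofReal_mul (by norm_num),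
        ← ENNReal.ofReal_mul (by positivity)]
      congr 1; ring

end IsUnconditionalLogConcave

/-! ### Transfer to random vectors -/

section RandomVector

variable {Ω : Type*} [MeasurableSpace Ω] {n : ℕ} {P : Measure Ω}
  {X : Ω → EuclideanSpace ℝ (Fin n)}

theorem evariance_map {Ω' : Type*} [MeasurableSpace Ω'] {Y : Ω → Ω'} (hY : AEMeasurable Y P)
    {f : Ω' → ℝ} (hf : Measurable f) : evariance f (P.map Y) = evariance (fun ω => f (Y ω)) P := by
  simp only [evariance_eq_lintegral_ofReal]
  rw [lintegral_map' (by fun_prop) hY, integral_map hY hf.aestronglyMeasurable]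

/-- Neither hypothesis depends on the norm, so the law moves to `Fin n → ℝ`, where induction on
coordinates is available. -/
theorem isUnconditionalLogConcave_map_ofLp (hX : AEMeasurable X P)
    (hsymm : IsCoordinatewiseSymmetric X P) (hlc : IsLogConcaveMeasure (P.map X)) :
    IsUnconditionalLogConcave (P.map fun ω => (X ω).ofLp) := by
  have hmap : P.map (fun ω => (X ω).ofLp) =
      (P.map X).map (MeasurableEquiv.toLp 2 (Fin n → ℝ)).symm := by
    rw [AEMeasurable.map_map_of_aemeasurable (MeasurableEquiv.measurable _).aemeasurable hX]
    rfl
  have hm : AEMeasurable (fun ω => (X ω).ofLp) P :=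
    (MeasurableEquiv.toLp 2 (Fin n → ℝ)).symm.measurable.comp_aemeasurable hX
  constructor
  · intro A B hA hB hA' hB' t ht0 ht1
    have hpre (S : Set (Fin n → ℝ)) : (MeasurableEquiv.toLp 2 (Fin n → ℝ)).symm ⁻¹' S =
        WithLp.toLp 2 '' S := by
      ext x
      constructor
      · intro hx
        exact ⟨x.ofLp, hx, rfl⟩
      · rintro ⟨y, hy, rfl⟩
        exact hy
    rw [hmap]
    simp only [MeasurableEquiv.map_apply, hpre]
    refine (hlc _ _ (hA.image (PiLp.continuous_toLp 2 _)) (hB.image (PiLp.continuous_toLp 2 _))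
      (hA'.image _) (hB'.image _) t ht0 ht1).trans (measure_mono ?_)
    rintro _ ⟨_, ⟨_, ⟨u, hu, rfl⟩, rfl⟩, _, ⟨_, ⟨v, hv, rfl⟩, rfl⟩, rfl⟩
    exact ⟨t • u + (1 - t) • v, ⟨_, ⟨u, hu, rfl⟩, _, ⟨v, hv, rfl⟩, rfl⟩, rfl⟩
  · intro ε hε
    rw [AEMeasurable.map_map_of_aemeasurable (Measurable.aemeasurable (by fun_prop)) hm]
    have h := (hsymm ε hε).map_eq
    have h' := congrArg (Measure.map (MeasurableEquiv.toLp 2 (Fin n → ℝ)).symm) h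
    rw [AEMeasurable.map_map_of_aemeasurable (MeasurableEquiv.measurable _).aemeasurable
      (hsymm ε hε).aemeasurable_fst, ← hmap] at h'
    exact h'

theorem IsIsotropic.lintegral_sq_eq_one [IsProbabilityMeasure P] (hX : IsIsotropic X P)
    (i : Fin n) : ∫⁻ ω, ENNReal.ofReal (X ω i ^ 2) ∂P = 1 := by
  have h := evariance_eq_lintegral_ofReal (fun ω => X ω i) P
  rw [← ofReal_variance (hX.memLp i), hX.variance_eq_one, hX.mean_eq_zero] at h
  simpa using h.symm

/-- The identity matrix has quadratic form `‖x‖ ^ 2` and sum of squared entries `n`. -/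
theorem sigmaFourSq_le_optimalLambda : sigmaFourSq X P ≤ optimalLambda X P := by
  refine le_sInf fun L hL => ?_
  have h := hL fun i j => if i = j then 1 else 0
  have e : (fun ω => ∑ i, ∑ j, (if i = j then (1 : ℝ) else 0) * X ω i * X ω j) =
      fun ω => ‖X ω‖ ^ 2 := by
    ext ω
    rw [EuclideanSpace.real_norm_sq_eq]
    simp [sq]
  rw [e] at h
  refine ENNReal.div_le_of_le_mul (h.trans (le_of_eq ?_))
  simp

end RandomVector

theorem proposition3p3 :
    ∃ c : ℝ, 0 < c ∧
      ∀ (n : ℕ), 2 ≤ n →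
      ∀ (Ω : Type*) [MeasurableSpace Ω] (P : Measure Ω) [IsProbabilityMeasure P]
        (X : Ω → EuclideanSpace ℝ (Fin n)),
        AEMeasurable X P →
        IsIsotropic X P →
        IsCoordinatewiseSymmetric X P →
        IsLogConcaveMeasure (P.map X) →
        sigmaFourSq X P ≤ optimalLambda X P ∧ optimalLambda X P ≤ ENNReal.ofReal c := by
  -- The summand 1 only secures strict positivity.
  refine ⟨36 * fourthMomentBound + 1, by linarith [fourthMomentBound_nonneg], ?_⟩
  intro n _ Ω _ P _ X hX hiso hsymm hlc
  refine ⟨sigmaFourSq_le_optimalLambda, sInf_le fun a => ?_⟩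
  have hm : AEMeasurable (fun ω => (X ω).ofLp) P :=
    (MeasurableEquiv.toLp 2 (Fin n → ℝ)).symm.measurable.comp_aemeasurable hX
  have hμ := isUnconditionalLogConcave_map_ofLp hX hsymm hlc
  have : IsProbabilityMeasure (P.map fun ω => (X ω).ofLp) := Measure.isProbabilityMeasure_map hm
  have key := hμ.evariance_quadratic_le (fun i => by
    rw [lintegral_map' (Measurable.aemeasurable (by fun_prop)) hm]
    exact (hiso.lintegral_sq_eq_one i).le) a
  rw [evariance_map hm (by fun_prop)] at key
  refine key.trans ?_
  gcongr
  linarith
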